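/- For $\alpha,\lambda>0$ let $\Gamma(\alpha,\lambda)$ be the Gamma distribution with density $\frac{\lambda^\alpha}{\Gamma(\alpha)}x^{\alpha-1}e^{-\lambda x}\mathbf 1_{(0,\infty)}(x)$. For $\alpha^\pm,\lambda^\pm>0$ the bilateral Gamma distribution $\Gamma(\alpha^+,\lambda^+;\alpha^-,\lambda^-)$ is the law of $Y-Z$ with independent $Y\sim\Gamma(\alpha^+,\lambda^+)$, $Z\sim\Gamma(\alpha^-,\lambda^-)$. A process $X=(X_t)_{t\ge 0}$ on a filtered probability space $(\Omega,\mathcal F,(\mathcal F_t)_{t\ge0},\mathbb P)$ is a bilateral Gamma process, written $X\sim\Gamma(\alpha^+,\lambda^+;\alpha^-,\lambda^-)$, if it is an $(\mathcal F_t)$-Lévy process (adapted, càdlàg, $X_0=0$ a.s., with stationary increments $X_t-X_s$ independent of $\mathcal F_s$) and $X_1$ has the distribution $\Gamma(\alpha^+,\lambda^+;\alpha^-,\lambda^-)$. Let $X\sim\Gamma(\alpha^+,\lambda^+;\alpha^-,\lambda^-)$ under $\mathbb P$, let $r\ge q\ge 0$ and $S_0>0$, let $S_t=S_0e^{X_t}$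 and let $\tilde S_t=e^{-(r-q)t}S_t$ be the discounted price. Let $\Psi(\Theta)=\ln\mathbb E[e^{\Theta X_1}]$. For $\Theta\in(-\lambda^-,\lambda^+)$ the Esscher transform $\mathbb P^\Theta$ is given locally, i.e. by its restrictions to the $\sigma$-algebras $\mathcal F_t$: $$\frac{d\mathbb P^\Theta}{d\mathbb P}\Big|_{\mathcal F_t}=e^{\Theta X_t-\Psi(\Theta)t},\qquad t\ge 0 .$$ A property of a process holds under such a locally given measure if, for every $T\geq 0$, it holds on $[0,T]$ under the restriction of the measure to $\mathcal F_T$. $\mathbb P^\Theta$ is called a martingale measure if it is a probability measure locally equivalent to $\mathbb P$ (that is, its restrictions to the $\mathcal F_t$ are consistent probability measures, equivalent to those of $\mathbb P$) under which $\tilde S$ is a local martingale. Then the following holds. (0) For every $\Theta\in(-\lambda^-,\lambda^+)$, $\mathbb P^\Theta$ is a probability measure locally equivalent to $\mathbb P$. (1) There exists $\Theta\in(-\lambda^-,\lambda^+)$ such that $\mathbb P^\Theta$ is a martingale measure if and only if $\lambda^++\lambda^->1$. (2) If $\lambda^++\lambda^->1$, then the parameter $\Theta\in(-\lambda^-,\lambda^+)$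 for which $\mathbb P^\Theta$ is a martingale measure is unique, it belongs to $(-\lambda^-,\lambda^+-1)$, and it is the unique solution of $$\left(\frac{\lambda^+-\Theta}{\lambda^+-\Theta-1}\right)^{\alpha^+}\left(\frac{\lambda^-+\Theta}{\lambda^-+\Theta+1}\right)^{\alpha^-}=e^{r-q},\qquad \Theta\in(-\lambda^-,\lambda^+-1).$$ Moreover, for this $\Theta$, $\tilde S$ is even a true martingale under $\mathbb P^\Theta$, and $X\sim\Gamma(\alpha^+,\lambda^+-\Theta;\alpha^-,\lambda^-+\Theta)$ under $\mathbb P^\Theta$. (3) If $\Theta\in(-\lambda^-,\lambda^+)$ and $\mathbb Q$ is a probability measure on $\mathcal F$ whose restriction to $\mathcal F_t$ is that of $\mathbb P^\Theta$ for every $t\ge0$, then $\tilde S$ is a local $\mathbb Q$-martingale if and only if it is a true $\mathbb Q$-martingale, if and only if $\mathbb P^\Theta$ is a martingale measure; and $X\sim\Gamma(\alpha^+,\lambda^+-\Theta;\alpha^-,\lambda^-+\Theta)$ under $\mathbb Q$. -/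

import Mathlib

open MeasureTheory ProbabilityTheory Filter Topology
open scoped NNReal ENNReal MeasureTheory

namespace BilateralGamma

noncomputable section

/-- The bilateral Gamma distribution `Γ(ap, lp; am, lm)`: the law of `Y - Z` for independent
`Y ~ Γ(ap, lp)` and `Z ~ Γ(am, lm)`. Here `ap`, `lp` stand for `α⁺`, `λ⁺` and `am`, `lm` for
`α⁻`, `λ⁻`; the second parameter of a Gamma distribution is its rate. -/
def bilateralGamma (ap lp am lm : ℝ) : Measure ℝ :=
  ((gammaMeasure ap lp).prod (gammaMeasure am lm)).map (fun p => p.1 - p.2)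

/-- `x : ℝ≥0 → ℝ` is right continuous and has left limits. -/
def IsCadlagPath (x : ℝ≥0 → ℝ) : Prop :=
  ∀ t, ContinuousWithinAt x (Set.Ici t) t ∧ ∃ l, Tendsto x (𝓝[<] t) (𝓝 l)

section Global

variable {Ω : Type*} {m : MeasurableSpace Ω}

/-- `X` is a real Lévy process with respect to the filtration `ℱ` under `P`: adapted, càdlàg,
started at zero, its increments are independent of the past, and they are stationary. -/
structure IsLevyProcess (ℱ : Filtration ℝ≥0 m) (P : Measure Ω) (X : ℝ≥0 → Ω → ℝ) : Prop where
  adapted : ∀ t, Measurable[ℱ t] (X t)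
  cadlag : ∀ ω, IsCadlagPath (fun t => X t ω)
  zero : ∀ᵐ ω ∂P, X 0 ω = 0
  indep : ∀ s t, s ≤ t → Indep (MeasurableSpace.comap (X t - X s) inferInstance) (ℱ s) P
  stationary : ∀ s t, s ≤ t → P.map (X t - X s) = P.map (X (t - s))

/-- `X ~ Γ(ap, lp; am, lm)` under `P`: `X` is a bilateral Gamma process, that is, a Lévy process
such that `X 1` has the bilateral Gamma distribution with these parameters. -/
structure IsBilateralGammaProcess (ℱ : Filtration ℝ≥0 m) (P : Measure Ω) (X : ℝ≥0 → Ω → ℝ)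
    (ap lp am lm : ℝ) : Prop extends IsLevyProcess ℱ P X where
  law_one : P.map (X 1) = bilateralGamma ap lp am lm

/-- `Y` is a (càdlàg) local martingale under `P` with respect to `ℱ`. -/
def IsLocalMartingale (ℱ : Filtration ℝ≥0 m) (P : Measure Ω) (Y : ℝ≥0 → Ω → ℝ) : Prop :=
  Locally (fun Z => Martingale Z ℱ P ∧ ∀ ω, IsCadlagPath (fun t => Z t ω)) ℱ Y P

end Global

section Local

variable {Ω : Type*} {m : MeasurableSpace Ω}

/-- The filtration `(ℱ (min t T))_t` on the measurable space `(Ω, ℱ T)`. -/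
def filtrationUpTo (ℱ : Filtration ℝ≥0 m) (T : ℝ≥0) : Filtration ℝ≥0 (ℱ T) where
  seq t := ℱ (min t T)
  mono' _ _ h := ℱ.mono (min_le_min_right T h)
  le' t := ℱ.mono (min_le_right t T)

/-- `Q` is a measure given locally on the filtered space, that is, by its restrictions `Q t`
to the σ-algebras `ℱ t`; it is a probability measure, and it is locally equivalent to `P`. -/
structure IsLocallyEquivalent (ℱ : Filtration ℝ≥0 m) (P : Measure Ω)
    (Q : ∀ t : ℝ≥0, Measure[ℱ t] Ω) : Prop where
  prob : ∀ t, IsProbabilityMeasure (Q t)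
  consistent : ∀ s t (h : s ≤ t), (Q t).trim (ℱ.mono h) = Q s
  ac : ∀ t, Q t ≪ P.trim (ℱ.le t)
  ac' : ∀ t, P.trim (ℱ.le t) ≪ Q t

/-- `Y` is a martingale under the locally given measure `Q`: on every `[0, T]` it is a martingale
under the restriction `Q T` of `Q` to `ℱ T`. -/
def IsMartingaleUnder (ℱ : Filtration ℝ≥0 m) (Q : ∀ t : ℝ≥0, Measure[ℱ t] Ω)
    (Y : ℝ≥0 → Ω → ℝ) : Prop :=
  ∀ T, Martingale (fun t => Y (min t T)) (filtrationUpTo ℱ T) (Q T)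

/-- `Y` is a local martingale under the locally given measure `Q`: on every `[0, T]` it is a
local martingale under the restriction `Q T` of `Q` to `ℱ T`. -/
def IsLocalMartingaleUnder (ℱ : Filtration ℝ≥0 m) (Q : ∀ t : ℝ≥0, Measure[ℱ t] Ω)
    (Y : ℝ≥0 → Ω → ℝ) : Prop :=
  ∀ T, IsLocalMartingale (filtrationUpTo ℱ T) (Q T) (fun t => Y (min t T))

/-- `Q` is a martingale measure for `Y`: a probability measure, given locally and locally
equivalent to `P`, under which `Y` is a local martingale. -/
def IsMartingaleMeasure (ℱ : Filtration ℝ≥0 m) (P : Measure Ω)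
    (Q : ∀ t : ℝ≥0, Measure[ℱ t] Ω) (Y : ℝ≥0 → Ω → ℝ) : Prop :=
  IsLocallyEquivalent ℱ P Q ∧ IsLocalMartingaleUnder ℱ Q Y

/-- `X` is a Lévy process under the locally given measure `Q`. Every clause concerns events of a
single `ℱ t` only. -/
structure IsLevyProcessUnder (ℱ : Filtration ℝ≥0 m) (Q : ∀ t : ℝ≥0, Measure[ℱ t] Ω)
    (X : ℝ≥0 → Ω → ℝ) : Prop where
  adapted : ∀ t, Measurable[ℱ t] (X t)
  cadlag : ∀ ω, IsCadlagPath (fun t => X t ω)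
  zero : ∀ᵐ ω ∂(Q 0), X 0 ω = 0
  indep : ∀ s t, s ≤ t → Indep (MeasurableSpace.comap (X t - X s) inferInstance) (ℱ s) (Q t)
  stationary : ∀ s t, s ≤ t →
    @Measure.map Ω ℝ (ℱ t) _ (X t - X s) (Q t) =
      @Measure.map Ω ℝ (ℱ (t - s)) _ (X (t - s)) (Q (t - s))

/-- `X ~ Γ(ap, lp; am, lm)` under the locally given measure `Q`. -/
structure IsBilateralGammaProcessUnder (ℱ : Filtration ℝ≥0 m)
    (Q : ∀ t : ℝ≥0, Measure[ℱ t] Ω) (X : ℝ≥0 → Ω → ℝ) (ap lp am lm : ℝ) : Prop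
    extends IsLevyProcessUnder ℱ Q X where
  law_one : @Measure.map Ω ℝ (ℱ 1) _ (X 1) (Q 1) = bilateralGamma ap lp am lm

/-- The Esscher transform `P^Θ`: the measure given locally by the likelihood process
`exp (Θ X_t - Ψ(Θ) t)`, where `Ψ` is the cumulant generating function of `X 1` under `P`. -/
def esscher (ℱ : Filtration ℝ≥0 m) (P : Measure Ω) (X : ℝ≥0 → Ω → ℝ) (Θ : ℝ) :
    ∀ t : ℝ≥0, Measure[ℱ t] Ω := fun t =>
  (P.trim (ℱ.le t)).withDensity
    (fun ω => ENNReal.ofReal (Real.exp (Θ * X t ω - cgf (X 1) P Θ * t)))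

end Local

/-- The discounted price `e^{-(r-q)t} S_t` of the stock `S_t = S₀ e^{X_t}`. -/
def discountedPrice {Ω : Type*} (S₀ r q : ℝ) (X : ℝ≥0 → Ω → ℝ) (t : ℝ≥0) (ω : Ω) : ℝ :=
  Real.exp (-(r - q) * t) * (S₀ * Real.exp (X t ω))

/-- The equation
`((lp - Θ)/(lp - Θ - 1))^ap * ((lm + Θ)/(lm + Θ + 1))^am = e^{r-q}` for the Esscher parameter. -/
def EsscherEquation (ap lp am lm r q Θ : ℝ) : Prop :=
  ((lp - Θ) / (lp - Θ - 1)) ^ ap * ((lm + Θ) / (lm + Θ + 1)) ^ am = Real.exp (r - q)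

end

end BilateralGamma

namespace BilateralGamma

/-! ### Exponential tilting of Gamma and bilateral Gamma distributions -/

/-! Tilting a Gamma law by `exp (θ * x)` only shifts its rate, so tilting `bilateralGamma` moves
`lp` to `lp - Θ` and `lm` to `lm + Θ`. The normalising constant is the moment generating function
`bilateralMGF`, finite on `(-lm, lp)`; for `θ ≥ lp` the exponential moment is infinite. For a Lévy
process exponential moments are multiplicative in time, and with right continuity this gives `E exp
(θ X_t) = exp (t Ψ(θ))` (`IsLevyProcess.expMoment_eq_exp`). The Esscher density is therefore a
positive martingale of mean one. It factorises over increments, so `X` stays a Lévy process after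
the change of measure (`IsLevyProcess.lintegral_mul_increment_esscher`). If `Θ < lp - 1`, the
conditional expectation of the discounted price at `t` given `ℱ s` is its value at `s` times `exp (κ
(t - s))`, where `κ = Ψ(Θ+1) - Ψ(Θ) - (r - q)` is `drift`
(`IsBilateralGammaProcess.lintegral_price`). If `Θ ≥ lp - 1`, the price has infinite expectation at
time `1`. Hence the price is a true martingale as soon as `Θ < lp - 1` and `κ = 0`, and `κ = 0` is
the Esscher equation. The left side of that equation increases strictly from `0` to `∞` on `(-lm, lp
- 1)`, an interval that is nonempty exactly when `lp + lm > 1`. It remains to see that a local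
martingale already forces `Θ < lp - 1` and `κ = 0`. By Fatou a nonnegative local martingale has
expectation at most its initial one, which excludes `Θ ≥ lp - 1` and `κ > 0`. When `κ ≤ 0`, the
price is a decreasing deterministic factor times a martingale, and optional sampling with dominated
convergence along the localising sequence yields the opposite inequality
(`IsLocalMartingale.lintegral_zero_le`), so `κ = 0`. -/

lemma gammaPDF_mul_exp {a r θ : ℝ} (ha : 0 < a) (hr : 0 < r) (hθ : θ < r) (x : ℝ) :
    gammaPDF a r x * ENNReal.ofReal (Real.exp (θ * x)) =
      ENNReal.ofReal ((r / (r - θ)) ^ a) * gammaPDF a (r - θ) x := by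
  have hrθ : 0 < r - θ := sub_pos.2 hθ
  rcases lt_or_ge x 0 with hx | hx
  · simp [gammaPDF_of_neg hx]
  · rw [gammaPDF_of_nonneg hx, gammaPDF_of_nonneg hx, ← ENNReal.ofReal_mul (by positivity),
      ← ENNReal.ofReal_mul (by positivity)]
    congr 1
    have h1 : (r - θ) ^ a ≠ 0 := (Real.rpow_pos_of_pos hrθ a).ne'
    have h2 : Real.exp (-((r - θ) * x)) = Real.exp (-(r * x)) * Real.exp (θ * x) := by
      rw [← Real.exp_add]; ring_nf
    rw [Real.div_rpow hr.le hrθ.le, h2]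
    field_simp

lemma gammaMeasure_withDensity_exp {a r θ : ℝ} (ha : 0 < a) (hr : 0 < r) (hθ : θ < r) :
    (gammaMeasure a r).withDensity (fun x => ENNReal.ofReal (Real.exp (θ * x))) =
      ENNReal.ofReal ((r / (r - θ)) ^ a) • gammaMeasure a (r - θ) := by
  have hm : ∀ s, Measurable (gammaPDF a s) := fun s =>
    (measurable_gammaPDFReal a s).ennreal_ofReal
  rw [gammaMeasure, gammaMeasure, ← withDensity_mul _ (hm r) (by fun_prop),
    ← withDensity_smul _ (hm _)]
  congr 1
  ext x
  exact gammaPDF_mul_exp ha hr hθ x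

lemma lintegral_exp_gammaMeasure {a r θ : ℝ} (ha : 0 < a) (hr : 0 < r) (hθ : θ < r) :
    ∫⁻ x, ENNReal.ofReal (Real.exp (θ * x)) ∂gammaMeasure a r =
      ENNReal.ofReal ((r / (r - θ)) ^ a) := by
  have := isProbabilityMeasure_gammaMeasure ha (sub_pos.2 hθ)
  rw [← setLIntegral_univ, ← withDensity_apply _ MeasurableSet.univ,
    gammaMeasure_withDensity_exp ha hr hθ]
  simp

lemma ae_nonneg_gammaMeasure (a r : ℝ) : ∀ᵐ x ∂gammaMeasure a r, 0 ≤ x := by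
  rw [ae_iff, gammaMeasure]
  have : {x : ℝ | ¬ 0 ≤ x} = Set.Iio 0 := by ext; simp
  rw [this, withDensity_apply _ measurableSet_Iio]
  exact lintegral_gammaPDF_of_nonpos le_rfl

/-- The law lives on `x ≥ 0`, so the integral dominates the explicit values at every `η < r`, and
these blow up as `η` increases to `r`. -/
lemma lintegral_exp_gammaMeasure_eq_top {a r θ : ℝ} (ha : 0 < a) (hr : 0 < r) (hθ : r ≤ θ) :
    ∫⁻ x, ENNReal.ofReal (Real.exp (θ * x)) ∂gammaMeasure a r = ⊤ := by
  have hlim : Tendsto (fun η : ℝ => ENNReal.ofReal ((r / (r - η)) ^ a)) (𝓝[<] r) (𝓝 ⊤) := by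
    refine ENNReal.tendsto_ofReal_atTop.comp ((tendsto_rpow_atTop ha).comp ?_)
    refine Tendsto.const_mul_atTop hr ?_
    refine tendsto_inv_nhdsGT_zero.comp ?_
    refine tendsto_nhdsWithin_iff.2 ⟨?_, ?_⟩
    · have : Tendsto (fun η : ℝ => r - η) (𝓝 r) (𝓝 (r - r)) :=
        tendsto_const_nhds.sub tendsto_id
      rw [sub_self] at this
      exact this.mono_left nhdsWithin_le_nhds
    · filter_upwards [self_mem_nhdsWithin] with η hη using sub_pos.2 (Set.mem_Iio.1 hη)
  refine top_le_iff.1 (le_of_tendsto hlim ?_)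
  filter_upwards [self_mem_nhdsWithin] with η hη
  rw [← lintegral_exp_gammaMeasure ha hr hη]
  refine lintegral_mono_ae ?_
  filter_upwards [ae_nonneg_gammaMeasure a r] with x hx
  have hη' : η ≤ θ := (le_of_lt hη).trans hθ
  gcongr

/-- The moment generating function of the bilateral Gamma distribution. -/
noncomputable def bilateralMGF (ap lp am lm θ : ℝ) : ℝ :=
  (lp / (lp - θ)) ^ ap * (lm / (lm + θ)) ^ am

lemma bilateralMGF_pos {ap lp am lm θ : ℝ} (hlp : 0 < lp) (hlm : 0 < lm)
    (hθ : θ ∈ Set.Ioo (-lm) lp) : 0 < bilateralMGF ap lp am lm θ := by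
  have h1 : 0 < lp - θ := sub_pos.2 hθ.2
  have h2 : 0 < lm + θ := by linarith [hθ.1]
  unfold bilateralMGF
  positivity

instance sfinite_gammaMeasure (a r : ℝ) : SFinite (gammaMeasure a r) := by unfold gammaMeasure; infer_instance

lemma isProbabilityMeasure_bilateralGamma {ap lp am lm : ℝ} (hap : 0 < ap) (hlp : 0 < lp)
    (ham : 0 < am) (hlm : 0 < lm) : IsProbabilityMeasure (bilateralGamma ap lp am lm) := by
  have := isProbabilityMeasure_gammaMeasure hap hlp
  have := isProbabilityMeasure_gammaMeasure ham hlm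
  exact Measure.isProbabilityMeasure_map (by fun_prop)

lemma ofReal_exp_mul_sub (θ x y : ℝ) : ENNReal.ofReal (Real.exp (θ * (x - y))) =
    ENNReal.ofReal (Real.exp (θ * x)) * ENNReal.ofReal (Real.exp (-θ * y)) := by
  rw [← ENNReal.ofReal_mul (Real.exp_nonneg _), ← Real.exp_add]
  ring_nf

/-- The exponential of a difference factorises, so the tilt of the product measure is the product of
the Gamma tilts by `θ` and `-θ`. -/
lemma bilateralGamma_withDensity_exp {ap lp am lm θ : ℝ} (hap : 0 < ap) (hlp : 0 < lp)
    (ham : 0 < am) (hlm : 0 < lm) (hθ : θ ∈ Set.Ioo (-lm) lp) :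
    (bilateralGamma ap lp am lm).withDensity (fun x => ENNReal.ofReal (Real.exp (θ * x))) =
      ENNReal.ofReal (bilateralMGF ap lp am lm θ) •
        bilateralGamma ap (lp - θ) am (lm + θ) := by
  have h2 : -θ < lm := by linarith [hθ.1]
  have hp := isProbabilityMeasure_gammaMeasure hap (sub_pos.2 hθ.2)
  have hsub : Measurable fun p : ℝ × ℝ => p.1 - p.2 := by fun_prop
  ext s hs
  rw [withDensity_apply _ hs, bilateralGamma, setLIntegral_map hs (by fun_prop) hsub]
  simp_rw [ofReal_exp_mul_sub]
  have h1 : 0 ≤ (lp / (lp - θ)) ^ ap :=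
    Real.rpow_nonneg (div_nonneg hlp.le (sub_pos.2 hθ.2).le) _
  rw [← withDensity_apply _ (hsub hs), ← prod_withDensity
      (f := fun x => ENNReal.ofReal (Real.exp (θ * x)))
      (g := fun x => ENNReal.ofReal (Real.exp (-θ * x))) (by fun_prop) (by fun_prop),
    gammaMeasure_withDensity_exp hap hlp hθ.2, gammaMeasure_withDensity_exp ham hlm h2,
    Measure.prod_smul_left, Measure.prod_smul_right, smul_smul, bilateralGamma,
    Measure.smul_apply, Measure.smul_apply, Measure.map_apply hsub hs, sub_neg_eq_add,
    bilateralMGF, ENNReal.ofReal_mul h1]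

lemma lintegral_exp_bilateralGamma {ap lp am lm θ : ℝ} (hap : 0 < ap) (hlp : 0 < lp)
    (ham : 0 < am) (hlm : 0 < lm) (hθ : θ ∈ Set.Ioo (-lm) lp) :
    ∫⁻ x, ENNReal.ofReal (Real.exp (θ * x)) ∂bilateralGamma ap lp am lm =
      ENNReal.ofReal (bilateralMGF ap lp am lm θ) := by
  have := isProbabilityMeasure_bilateralGamma hap (sub_pos.2 hθ.2) ham
    (show 0 < lm + θ by linarith [hθ.1])
  rw [← setLIntegral_univ, ← withDensity_apply _ MeasurableSet.univ,
    bilateralGamma_withDensity_exp hap hlp ham hlm hθ]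
  simp

/-- The integral factorises; the positive part contributes `⊤` and the negative part a nonzero
factor, so the product is not the degenerate `⊤ * 0`. -/
lemma lintegral_exp_bilateralGamma_eq_top {ap lp am lm θ : ℝ} (hap : 0 < ap) (hlp : 0 < lp)
    (ham : 0 < am) (hlm : 0 < lm) (hθ : lp ≤ θ) :
    ∫⁻ x, ENNReal.ofReal (Real.exp (θ * x)) ∂bilateralGamma ap lp am lm = ⊤ := by
  have hθ' : -θ < lm := by linarith
  rw [bilateralGamma, lintegral_map (by fun_prop) (by fun_prop)]
  simp_rw [ofReal_exp_mul_sub]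
  rw [lintegral_prod_mul (f := fun x => ENNReal.ofReal (Real.exp (θ * x)))
      (g := fun x => ENNReal.ofReal (Real.exp (-θ * x))) (by fun_prop) (by fun_prop), lintegral_exp_gammaMeasure_eq_top hap hlp hθ,
    lintegral_exp_gammaMeasure ham hlm hθ', ENNReal.top_mul]
  have h0 : 0 < lm - -θ := by linarith
  have : 0 < (lm / (lm - -θ)) ^ am := by positivity
  simpa using this

/-! ### The equation for the Esscher parameter -/

/-- The left-hand side of the Esscher equation. -/
noncomputable def esscherRatio (ap lp am lm θ : ℝ) : ℝ :=
  ((lp - θ) / (lp - θ - 1)) ^ ap * ((lm + θ) / (lm + θ + 1)) ^ am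

/-- Links the exponential growth of the price, governed by `Ψ(Θ+1) - Ψ(Θ)`, to the explicit equation
for `Θ`. -/
lemma bilateralMGF_add_one {ap lp am lm θ : ℝ} (hlp : 0 < lp) (hlm : 0 < lm)
    (hθ : θ ∈ Set.Ioo (-lm) (lp - 1)) :
    bilateralMGF ap lp am lm (θ + 1) =
      esscherRatio ap lp am lm θ * bilateralMGF ap lp am lm θ := by
  have h1 : 0 < lp - θ := by linarith [hθ.2]
  have h2 : 0 < lp - θ - 1 := by linarith [hθ.2]
  have h3 : 0 < lm + θ := by linarith [hθ.1]
  have h4 : 0 < lm + θ + 1 := by linarith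
  have e1 : lp - (θ + 1) = lp - θ - 1 := by ring
  have e2 : lm + (θ + 1) = lm + θ + 1 := by ring
  rw [bilateralMGF, bilateralMGF, esscherRatio, e1, e2, mul_mul_mul_comm,
    ← Real.mul_rpow (by positivity) (by positivity),
    ← Real.mul_rpow (by positivity) (by positivity)]
  congr 2 <;> field_simp

/-- Both bases increase: `u / (u - 1)` decreases in `u = lp - θ`, and `v / (v + 1)` increases in `v
= lm + θ`. -/
lemma strictMonoOn_esscherRatio {ap lp am lm : ℝ} (hap : 0 < ap) (ham : 0 < am) :
    StrictMonoOn (esscherRatio ap lp am lm) (Set.Ioo (-lm) (lp - 1)) := by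
  intro x hx y hy hxy
  have h1 : 0 < lp - x - 1 := by linarith [hx.2]
  have h2 : 0 < lp - y - 1 := by linarith [hy.2]
  have h3 : 0 < lm + x := by linarith [hx.1]
  have h4 : 0 < lm + y := by linarith [hy.1]
  have h5 : 0 < lp - x := by linarith
  have h6 : 0 < lp - y := by linarith
  refine mul_lt_mul'' (Real.rpow_lt_rpow (by positivity) ?_ hap)
    (Real.rpow_lt_rpow (by positivity) ?_ ham) (by positivity) (by positivity)
  · rw [div_lt_div_iff₀ h1 h2]; nlinarith
  · rw [div_lt_div_iff₀ (by linarith) (by linarith)]; nlinarith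

lemma continuousOn_esscherRatio {ap lp am lm : ℝ} (hap : 0 < ap) (ham : 0 < am) :
    ContinuousOn (esscherRatio ap lp am lm) (Set.Ioo (-lm) (lp - 1)) := by
  unfold esscherRatio
  refine ContinuousOn.mul ?_ ?_
  · refine ContinuousOn.rpow_const (ContinuousOn.div (by fun_prop) (by fun_prop) ?_)
      fun _ _ => Or.inr hap.le
    intro x hx; linarith [hx.2]
  · refine ContinuousOn.rpow_const (ContinuousOn.div (by fun_prop) (by fun_prop) ?_)
      fun _ _ => Or.inr ham.le
    intro x hx; linarith [hx.1]

/-- The formula is continuous up to `-lm`, where the second base vanishes; `1 < lp + lm` keeps the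
first base finite and positive there. -/
lemma tendsto_esscherRatio_left {ap lp am lm : ℝ} (ham : 0 < am) (h : 1 < lp + lm) :
    Tendsto (esscherRatio ap lp am lm) (𝓝[>] (-lm)) (𝓝 0) := by
  have hc : ContinuousAt (esscherRatio ap lp am lm) (-lm) := by
    have h1 : lp - -lm - 1 ≠ 0 := by linarith
    have h3 : (lp - -lm) / (lp - -lm - 1) ≠ 0 := (div_pos (by linarith) (by linarith)).ne'
    have h2 : lm + -lm + 1 ≠ 0 := by norm_num
    unfold esscherRatio
    refine ContinuousAt.mul ?_ ?_
    · exact ContinuousAt.rpow_const (ContinuousAt.div (by fun_prop) (by fun_prop) h1) (Or.inl h3)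
    · exact ContinuousAt.rpow_const (ContinuousAt.div (by fun_prop) (by fun_prop) h2)
        (Or.inr ham.le)
  have h0 : esscherRatio ap lp am lm (-lm) = 0 := by
    simp [esscherRatio, Real.zero_rpow ham.ne']
  rw [← h0]
  exact hc.tendsto.mono_left nhdsWithin_le_nhds

lemma tendsto_esscherRatio_right {ap lp am lm : ℝ} (hap : 0 < ap) (h : 1 < lp + lm) :
    Tendsto (esscherRatio ap lp am lm) (𝓝[<] (lp - 1)) atTop := by
  have h3 : 0 < (lm + (lp - 1)) / (lm + (lp - 1) + 1) := div_pos (by linarith) (by linarith)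
  have hc : ContinuousAt (fun θ => ((lm + θ) / (lm + θ + 1)) ^ am) (lp - 1) := by
    have h2 : lm + (lp - 1) + 1 ≠ 0 := by linarith
    exact ContinuousAt.rpow_const (ContinuousAt.div (by fun_prop) (by fun_prop) h2)
      (Or.inl h3.ne')
  refine Tendsto.atTop_mul_pos (Real.rpow_pos_of_pos h3 am) ?_
    (hc.tendsto.mono_left nhdsWithin_le_nhds)
  refine (tendsto_rpow_atTop hap).comp ?_
  have hn : Tendsto (fun θ : ℝ => lp - θ) (𝓝[<] (lp - 1)) (𝓝 1) := by
    have : ContinuousAt (fun θ : ℝ => lp - θ) (lp - 1) := by fun_prop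
    simpa using this.tendsto.mono_left (nhdsWithin_le_nhds (s := Set.Iio (lp - 1)))
  simp_rw [div_eq_mul_inv]
  refine hn.pos_mul_atTop one_pos (tendsto_inv_nhdsGT_zero.comp ?_)
  refine tendsto_nhdsWithin_iff.2 ⟨?_, ?_⟩
  · simpa using hn.sub_const 1
  · filter_upwards [self_mem_nhdsWithin] with η hη
    have : η < lp - 1 := hη
    show 0 < lp - η - 1
    linarith

lemma exists_esscherRatio_eq {ap lp am lm y : ℝ} (hap : 0 < ap) (ham : 0 < am)
    (h : 1 < lp + lm) (hy : 0 < y) :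
    ∃ θ ∈ Set.Ioo (-lm) (lp - 1), esscherRatio ap lp am lm θ = y := by
  have hlt : -lm < lp - 1 := by linarith
  obtain ⟨a, ha, ha'⟩ := (((tendsto_esscherRatio_left (ap := ap) ham h).eventually
    (gt_mem_nhds hy)).and (Ioo_mem_nhdsGT hlt)).exists
  obtain ⟨b, hb, hb'⟩ := (((tendsto_esscherRatio_right (am := am) hap h).eventually
    (eventually_gt_atTop y)).and (Ioo_mem_nhdsLT hlt)).exists
  obtain ⟨θ, hθ, rfl⟩ := isPreconnected_Ioo.intermediate_value ha' hb'
    (continuousOn_esscherRatio hap ham) ⟨ha.le, hb.le⟩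
  exact ⟨θ, hθ, rfl⟩

/-! ### Exponential moments of Lévy processes -/

section Levy

variable {Ω : Type*} {m : MeasurableSpace Ω} {ℱ : Filtration ℝ≥0 m} {P : Measure Ω}
  {X : ℝ≥0 → Ω → ℝ}

namespace IsLevyProcess

lemma measurable (hX : IsLevyProcess ℱ P X) (t : ℝ≥0) : Measurable (X t) :=
  (hX.adapted t).mono (ℱ.le t) le_rfl

lemma lintegral_increment (hX : IsLevyProcess ℱ P X) {s t : ℝ≥0} (hst : s ≤ t) {g : ℝ → ℝ≥0∞}
    (hg : Measurable g) : ∫⁻ ω, g (X t ω - X s ω) ∂P = ∫⁻ ω, g (X (t - s) ω) ∂P := by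
  have h := hX.stationary s t hst
  rw [← lintegral_map (f := g) hg (hX.measurable (t - s)), ← h,
    lintegral_map hg ((hX.measurable t).sub (hX.measurable s))]
  rfl

lemma lintegral_mul_increment (hX : IsLevyProcess ℱ P X) {s t : ℝ≥0} (hst : s ≤ t)
    {f : Ω → ℝ≥0∞} (hf : Measurable[ℱ s] f) {g : ℝ → ℝ≥0∞} (hg : Measurable g) :
    ∫⁻ ω, f ω * g (X t ω - X s ω) ∂P = (∫⁻ ω, f ω ∂P) * ∫⁻ ω, g (X (t - s) ω) ∂P := by
  have hinc : Measurable (X t - X s) := (hX.measurable t).sub (hX.measurable s)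
  rw [← hX.lintegral_increment hst hg]
  refine lintegral_mul_eq_lintegral_mul_lintegral_of_independent_measurableSpace
    (ℱ.le s) hinc.comap_le (hX.indep s t hst).symm hf ?_
  exact hg.comp (comap_measurable (X t - X s))

end IsLevyProcess

/-- The exponential moment of order `θ` of `X t`. -/
noncomputable def expMoment (P : Measure Ω) (X : ℝ≥0 → Ω → ℝ) (θ : ℝ) (t : ℝ≥0) : ℝ≥0∞ :=
  ∫⁻ ω, ENNReal.ofReal (Real.exp (θ * X t ω)) ∂P

namespace IsLevyProcess

lemma lintegral_mul_exp (hX : IsLevyProcess ℱ P X) (θ : ℝ) {s t : ℝ≥0} (hst : s ≤ t)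
    {f : Ω → ℝ≥0∞} (hf : Measurable[ℱ s] f) :
    ∫⁻ ω, f ω * ENNReal.ofReal (Real.exp (θ * X t ω)) ∂P =
      (∫⁻ ω, f ω * ENNReal.ofReal (Real.exp (θ * X s ω)) ∂P) * expMoment P X θ (t - s) := by
  have hs := hX.adapted s
  have hm : Measurable[ℱ s] fun ω => f ω * ENNReal.ofReal (Real.exp (θ * X s ω)) :=
    hf.mul (hs.const_mul θ).exp.ennreal_ofReal
  rw [expMoment, ← hX.lintegral_mul_increment hst hm
    (g := fun x => ENNReal.ofReal (Real.exp (θ * x))) (by fun_prop)]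
  congr 1
  ext ω
  rw [mul_assoc, ← ENNReal.ofReal_mul (Real.exp_nonneg _), ← Real.exp_add]
  ring_nf

/-- Cauchy's functional equation in multiplicative form, valid in `ℝ≥0∞` without any integrability.
-/
lemma expMoment_add (hX : IsLevyProcess ℱ P X) (θ : ℝ) (s t : ℝ≥0) :
    expMoment P X θ (s + t) = expMoment P X θ s * expMoment P X θ t := by
  have h := hX.lintegral_mul_exp θ (le_self_add : s ≤ s + t) (f := fun _ => 1) measurable_const
  simpa [expMoment] using h

lemma expMoment_pos [IsProbabilityMeasure P] (hX : IsLevyProcess ℱ P X) (θ : ℝ) (t : ℝ≥0) :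
    0 < expMoment P X θ t := by
  have hm : Measurable fun ω => ENNReal.ofReal (Real.exp (θ * X t ω)) :=
    ((hX.measurable t).const_mul θ).exp.ennreal_ofReal
  rw [expMoment, lintegral_pos_iff_support hm]
  have : Function.support (fun ω => ENNReal.ofReal (Real.exp (θ * X t ω))) = Set.univ := by
    ext ω; simp [Real.exp_pos]
  simp [this]

lemma expMoment_zero [IsProbabilityMeasure P] (hX : IsLevyProcess ℱ P X) (θ : ℝ) :
    expMoment P X θ 0 = 1 := by
  have : ∫⁻ ω, ENNReal.ofReal (Real.exp (θ * X 0 ω)) ∂P = ∫⁻ _, 1 ∂P := by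
    refine lintegral_congr_ae ?_
    filter_upwards [hX.zero] with ω hω
    simp [hω]
  simp [expMoment, this]

lemma expMoment_nsmul [IsProbabilityMeasure P] (hX : IsLevyProcess ℱ P X) (θ : ℝ) (n : ℕ)
    (t : ℝ≥0) : expMoment P X θ (n * t) = expMoment P X θ t ^ n := by
  induction n with
  | zero => simp [hX.expMoment_zero]
  | succ n ih => rw [Nat.cast_succ, add_one_mul, hX.expMoment_add, ih, pow_succ]

/-- Right continuity of the paths and Fatou. Only an inequality comes out, since nothing here
permits exchanging limit and expectation. -/
lemma expMoment_le_of_forall_gt [IsProbabilityMeasure P] (hX : IsLevyProcess ℱ P X) {θ : ℝ}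
    {t : ℝ≥0} {q : ℕ → ℝ≥0} (hq : ∀ n, t ≤ q n) (hqt : Tendsto q atTop (𝓝 t)) {a : ℝ≥0∞}
    (ha : Tendsto (fun n => expMoment P X θ (q n)) atTop (𝓝 a)) : expMoment P X θ t ≤ a := by
  have hm : ∀ s, Measurable fun ω => ENNReal.ofReal (Real.exp (θ * X s ω)) := fun s =>
    ((hX.measurable s).const_mul θ).exp.ennreal_ofReal
  rw [← ha.liminf_eq]
  refine le_trans (lintegral_mono fun ω => ?_) (lintegral_liminf_le fun n => hm (q n))
  refine le_of_eq (Tendsto.liminf_eq ?_).symm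
  have hc := (hX.cadlag ω t).1
  have hX' : Tendsto (fun n => X (q n) ω) atTop (𝓝 (X t ω)) :=
    hc.tendsto.comp (tendsto_nhdsWithin_iff.2 ⟨hqt, Eventually.of_forall hq⟩)
  exact ENNReal.tendsto_ofReal ((hX'.const_mul θ).rexp)

/-- Both sides have the same `(b + 1)`-st power, computed from the moment at time `a`, and powers
are injective on `ℝ≥0∞`. -/
lemma expMoment_eq_exp_of_rat [IsProbabilityMeasure P] (hX : IsLevyProcess ℱ P X) {θ ψ : ℝ}
    (h1 : expMoment P X θ 1 = ENNReal.ofReal (Real.exp ψ)) (a b : ℕ) :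
    expMoment P X θ (a / (b + 1)) = ENNReal.ofReal (Real.exp ((a / (b + 1) : ℝ≥0) * ψ)) := by
  have hb : ((b + 1 : ℕ) : ℝ≥0) ≠ 0 := by positivity
  have h := hX.expMoment_nsmul θ (b + 1) (a / (b + 1))
  have h2 := hX.expMoment_nsmul θ a 1
  have e : ((b + 1 : ℕ) : ℝ≥0) * (a / (b + 1)) = a := by
    push_cast at hb ⊢
    field_simp
  rw [mul_one, h1] at h2
  rw [e, h2] at h
  refine (ENNReal.pow_right_strictMono (Nat.succ_ne_zero b)).injective ?_
  show _ ^ (b + 1) = _ ^ (b + 1)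
  rw [← h, ← ENNReal.ofReal_pow (Real.exp_nonneg _), ← ENNReal.ofReal_pow (Real.exp_nonneg _),
    ← Real.exp_nat_mul, ← Real.exp_nat_mul]
  congr 2
  push_cast
  have : (b + 1 : ℝ) ≠ 0 := by positivity
  field_simp

lemma expMoment_eq_exp [IsProbabilityMeasure P] (hX : IsLevyProcess ℱ P X) {θ ψ : ℝ}
    (h1 : expMoment P X θ 1 = ENNReal.ofReal (Real.exp ψ)) (t : ℝ≥0) :
    expMoment P X θ t = ENNReal.ofReal (Real.exp (t * ψ)) := by
  have hle : ∀ t : ℝ≥0, expMoment P X θ t ≤ ENNReal.ofReal (Real.exp (t * ψ)) := by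
    intro t
    -- Rational times approximating `t` from above, with error less than `1 / (n + 1)`.
    let q : ℕ → ℝ≥0 := fun n => ⌈(t : ℝ) * (n + 1)⌉₊ / (n + 1)
    have hq : ∀ n, t ≤ q n := fun n => by
      rw [le_div_iff₀ (by positivity), ← NNReal.coe_le_coe]
      push_cast
      exact Nat.le_ceil _
    have hqt : Tendsto q atTop (𝓝 t) := by
      have := (tendsto_nat_ceil_mul_div_atTop (R := ℝ) (a := t) t.2).comp
        (tendsto_natCast_atTop_atTop.comp (tendsto_add_atTop_nat 1))
      refine NNReal.tendsto_coe.1 (this.congr fun n => ?_)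
      simp [q]
    refine hX.expMoment_le_of_forall_gt hq hqt ?_
    have : (fun n => expMoment P X θ (q n)) =
        fun n => ENNReal.ofReal (Real.exp ((q n : ℝ≥0) * ψ)) := by
      ext n
      exact hX.expMoment_eq_exp_of_rat h1 _ n
    rw [this]
    refine ENNReal.tendsto_ofReal (Tendsto.rexp (Tendsto.mul_const ψ ?_))
    exact (NNReal.continuous_coe.tendsto t).comp hqt
  refine le_antisymm (hle t) ?_
  -- For the lower bound, split an integer time as `n = t + (n - t)`. The moment at `n` is known
  -- exactly and the factor at `n - t` is bounded above, so the factor at `t` cannot be too small.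
  obtain ⟨n, hn⟩ := exists_nat_ge t
  have hadd := hX.expMoment_add θ t (n - t)
  -- The choice `b = 0` makes the denominator `1`.
  have hint := hX.expMoment_eq_exp_of_rat h1 n 0
  simp only [CharP.cast_eq_zero, zero_add, div_one] at hint
  rw [add_tsub_cancel_of_le hn, hint] at hadd
  have hsplit : ENNReal.ofReal (Real.exp (((n : ℝ≥0) : ℝ) * ψ)) =
      ENNReal.ofReal (Real.exp (t * ψ)) * ENNReal.ofReal (Real.exp ((n - t : ℝ≥0) * ψ)) := by
    rw [← ENNReal.ofReal_mul (Real.exp_nonneg _), ← Real.exp_add, NNReal.coe_sub hn]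
    ring_nf
  have h2 : ENNReal.ofReal (Real.exp (t * ψ)) * ENNReal.ofReal (Real.exp ((n - t : ℝ≥0) * ψ)) ≤
      expMoment P X θ t * ENNReal.ofReal (Real.exp ((n - t : ℝ≥0) * ψ)) := by
    rw [← hsplit, hadd]
    exact mul_le_mul_right (hle _) _
  refine (ENNReal.mul_le_mul_iff_left ?_ ENNReal.ofReal_ne_top).1 h2
  simpa using Real.exp_pos _

end IsLevyProcess

end Levy

/-! ### Nonnegative martingales and local martingales -/

section Martingale

variable {Ω : Type*} {m : MeasurableSpace Ω} {𝒢 : Filtration ℝ≥0 m} {μ : Measure Ω}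
  {Y : ℝ≥0 → Ω → ℝ}

lemma martingale_of_setLIntegral_eq [IsProbabilityMeasure μ]
    (hadp : ∀ t, Measurable[𝒢 t] (Y t)) (hnn : ∀ t ω, 0 ≤ Y t ω)
    (hfin : ∀ t, ∫⁻ ω, ENNReal.ofReal (Y t ω) ∂μ ≠ ⊤)
    (hset : ∀ s t, s ≤ t → ∀ A, MeasurableSet[𝒢 s] A →
      ∫⁻ ω in A, ENNReal.ofReal (Y t ω) ∂μ = ∫⁻ ω in A, ENNReal.ofReal (Y s ω) ∂μ) :
    Martingale Y 𝒢 μ := by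
  have hsm : ∀ t, StronglyMeasurable[𝒢 t] (Y t) := fun t =>
    (hadp t).stronglyMeasurable
  have hint : ∀ t, Integrable (Y t) μ := fun t =>
    ⟨((hsm t).mono (𝒢.le t)).aestronglyMeasurable, by
      rw [hasFiniteIntegral_iff_ofReal (Eventually.of_forall (hnn t))]
      exact (hfin t).lt_top⟩
  refine ⟨hsm, fun s t hst => ?_⟩
  refine (ae_eq_condExp_of_forall_setIntegral_eq (𝒢.le s) (hint t)
    (fun A _ _ => (hint s).integrableOn) (fun A hA _ => ?_)
    (hsm s).aestronglyMeasurable).symm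
  have hY : ∀ t, ∫ ω in A, Y t ω ∂μ = (∫⁻ ω in A, ENNReal.ofReal (Y t ω) ∂μ).toReal := fun t =>
    integral_eq_lintegral_of_nonneg_ae (Eventually.of_forall (hnn t))
      (hint t).aestronglyMeasurable.restrict
  rw [hY, hY, hset s t hst A hA]

lemma lintegral_martingale_eq [IsProbabilityMeasure μ] (hY : Martingale Y 𝒢 μ)
    (hnn : ∀ t ω, 0 ≤ Y t ω) (t : ℝ≥0) :
    ∫⁻ ω, ENNReal.ofReal (Y t ω) ∂μ = ∫⁻ ω, ENNReal.ofReal (Y 0 ω) ∂μ := by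
  have h := hY.setIntegral_eq (zero_le (a := t)) MeasurableSet.univ
  rw [setIntegral_univ, setIntegral_univ] at h
  rw [← ofReal_integral_eq_lintegral_ofReal (hY.integrable t) (Eventually.of_forall (hnn t)),
    ← ofReal_integral_eq_lintegral_ofReal (hY.integrable 0) (Eventually.of_forall (hnn 0)), h]

lemma IsLocalMartingale.of_martingale (hY : Martingale Y 𝒢 μ)
    (hc : ∀ ω, IsCadlagPath (fun t => Y t ω)) : IsLocalMartingale 𝒢 μ Y :=
  Locally.of_prop ⟨hY, hc⟩

/-- On `{N = j}` the random time is the constant `g j`, and this piece of `A` is known at that time,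
so `hset` applies piece by piece. The bound `v` lets the weight be evaluated at a time other than
the discretised one. -/
lemma setLIntegral_comp_le_of_countable {T : ℝ≥0} {w : ℝ≥0 → ℝ≥0∞}
    (hYm : ∀ t, Measurable (Y t))
    (hset : ∀ s ≤ T, ∀ A, MeasurableSet[𝒢 s] A →
      ∫⁻ ω in A, ENNReal.ofReal (Y s ω) ∂μ = w s * ∫⁻ ω in A, ENNReal.ofReal (Y T ω) ∂μ)
    {N : Ω → ℕ} {g : ℕ → ℝ≥0} (hg : ∀ j, g j ≤ T)
    (hN : ∀ j, MeasurableSet[𝒢 (g j)] {ω | N ω = j}) {v : Ω → ℝ≥0∞} (hv : ∀ ω, w (g (N ω)) ≤ v ω)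
    {A : Set Ω} (hA : MeasurableSet[𝒢 0] A) :
    ∫⁻ ω in A, ENNReal.ofReal (Y (g (N ω)) ω) ∂μ ≤
      ∫⁻ ω in A, v ω * ENNReal.ofReal (Y T ω) ∂μ := by
  have hAU : A = ⋃ j, A ∩ {ω | N ω = j} := by
    ext ω; simp
  have hAm : ∀ j, MeasurableSet[𝒢 (g j)] (A ∩ {ω | N ω = j}) := fun j =>
    @MeasurableSet.inter Ω (𝒢 (g j)) _ _ (𝒢.mono zero_le _ hA) (hN j)
  have hAm' : ∀ j, MeasurableSet (A ∩ {ω | N ω = j}) := fun j => 𝒢.le _ _ (hAm j)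
  have hd : Pairwise (Function.onFun Disjoint fun j => A ∩ {ω | N ω = j}) := by
    intro i j hij
    refine Set.disjoint_left.2 fun ω hi hj => hij ?_
    exact hi.2.symm.trans hj.2
  rw [hAU, lintegral_iUnion hAm' hd, lintegral_iUnion hAm' hd]
  refine ENNReal.tsum_le_tsum fun j => ?_
  have h1 : ∫⁻ ω in A ∩ {ω | N ω = j}, ENNReal.ofReal (Y (g (N ω)) ω) ∂μ =
      ∫⁻ ω in A ∩ {ω | N ω = j}, ENNReal.ofReal (Y (g j) ω) ∂μ :=
    setLIntegral_congr_fun (hAm' j) fun ω hω => by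
      have : N ω = j := hω.2
      simp only [this]
  rw [h1, hset _ (hg j) _ (hAm j), ← lintegral_const_mul _ (hYm T).ennreal_ofReal]
  refine setLIntegral_mono' (hAm' j) fun ω hω => ?_
  have : N ω = j := hω.2
  exact mul_le_mul_left (this ▸ hv ω) _

/-- Rounding up to the grid of mesh `1 / (k + 1)`. The equivalence turns events about the rounded
time into events about the original one, which keeps rounded stopping times stopping times. -/
lemma exists_discretization : ∃ c : ℕ → ℝ≥0 → ℕ,
    (∀ k x j, c k x ≤ j ↔ x ≤ j / (k + 1)) ∧
      ∀ x, Tendsto (fun k => (c k x : ℝ≥0) / (k + 1)) atTop (𝓝 x) := by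
  refine ⟨fun k x => ⌈(x : ℝ) * (k + 1)⌉₊, fun k x j => ?_, fun x => ?_⟩
  · rw [le_div_iff₀ (by positivity), ← NNReal.coe_le_coe]
    push_cast
    exact Nat.ceil_le
  · have := (tendsto_nat_ceil_mul_div_atTop (R := ℝ) (a := x) x.2).comp
      (tendsto_natCast_atTop_atTop.comp (tendsto_add_atTop_nat 1))
    refine NNReal.tendsto_coe.1 (this.congr fun k => ?_)
    simp

/-- Optional sampling inequality for a process which becomes a martingale after multiplication
by a deterministic factor. -/
lemma setLIntegral_comp_le {T : ℝ≥0} {w : ℝ≥0 → ℝ≥0∞} (hw : Antitone w)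
    (hYm : ∀ t, Measurable (Y t))
    (hrc : ∀ ω t, ContinuousWithinAt (fun t => Y t ω) (Set.Ici t) t)
    (hset : ∀ s ≤ T, ∀ A, MeasurableSet[𝒢 s] A →
      ∫⁻ ω in A, ENNReal.ofReal (Y s ω) ∂μ = w s * ∫⁻ ω in A, ENNReal.ofReal (Y T ω) ∂μ)
    {ρ : Ω → ℝ≥0} (hρ : ∀ s, MeasurableSet[𝒢 s] {ω | ρ ω ≤ s}) (hρT : ∀ ω, ρ ω ≤ T)
    {A : Set Ω} (hA : MeasurableSet[𝒢 0] A) :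
    ∫⁻ ω in A, ENNReal.ofReal (Y (ρ ω) ω) ∂μ ≤
      ∫⁻ ω in A, w (ρ ω) * ENNReal.ofReal (Y T ω) ∂μ := by
  obtain ⟨c, hc, hct⟩ := exists_discretization
  -- The stopping time is rounded up, so that right continuity applies in the limit, and the grid is
  -- capped at `T`, the range in which `hset` is available.
  obtain ⟨N, hNc⟩ : ∃ N : ℕ → Ω → ℕ, ∀ k ω, N k ω = c k (ρ ω) := ⟨_, fun _ _ => rfl⟩
  obtain ⟨g, hg⟩ : ∃ g : ℕ → ℕ → ℝ≥0, ∀ k j, g k j = min T (j / (k + 1)) :=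
    ⟨_, fun _ _ => rfl⟩
  have hgT : ∀ k j, g k j ≤ T := fun k j => (hg k j).trans_le (min_le_left _ _)
  have hNle : ∀ k j ω, N k ω ≤ j ↔ ρ ω ≤ j / (k + 1) := fun k j ω => by
    rw [hNc]; exact hc k (ρ ω) j
  have hNle_meas : ∀ k j, MeasurableSet[𝒢 (g k j)] {ω | N k ω ≤ j} := by
    intro k j
    simp_rw [hNle]
    rcases le_total T (j / (k + 1)) with h | h
    · have : {ω | ρ ω ≤ j / (k + 1)} = Set.univ := by
        ext ω; simpa using (hρT ω).trans h
      rw [this]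
      exact @MeasurableSet.univ Ω (𝒢 (g k j))
    · have hgk : g k j = j / (k + 1) := (hg k j).trans (min_eq_right h)
      rw [hgk]
      exact hρ _
  have hg_mono : ∀ k, Monotone (g k) := fun k i j hij => by
    rw [hg, hg]
    exact min_le_min_left T (by gcongr)
  have hNeq_meas : ∀ k j, MeasurableSet[𝒢 (g k j)] {ω | N k ω = j} := by
    intro k j
    cases j with
    | zero => simpa using hNle_meas k 0
    | succ j =>
      have : {ω | N k ω = j + 1} = {ω | N k ω ≤ j + 1} \ {ω | N k ω ≤ j} := by
        ext ω; simp only [Set.mem_ofPred_eq, Set.mem_sdiff]; omega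
      rw [this]
      exact @MeasurableSet.diff Ω (𝒢 (g k (j + 1))) _ _ (hNle_meas k (j + 1))
        (𝒢.mono (hg_mono k (Nat.le_succ j)) _ (hNle_meas k j))
  have hN : ∀ k, Measurable (N k) := fun k =>
    measurable_to_countable' fun j => 𝒢.le _ _ (hNeq_meas k j)
  have hle : ∀ k ω, ρ ω ≤ g k (N k ω) := fun k ω => by
    rw [hg]
    exact le_min (hρT ω) ((hNle k _ ω).1 le_rfl)
  have hlim : ∀ ω, Tendsto (fun k => g k (N k ω)) atTop (𝓝 (ρ ω)) := by
    intro ω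
    have := (tendsto_const_nhds (x := T)).min (hct (ρ ω))
    rw [min_eq_right (hρT ω)] at this
    exact this.congr fun k => by rw [hg, hNc]
  have hY_meas : ∀ k, Measurable fun ω => Y (g k (N k ω)) ω := fun k =>
    (measurable_from_prod_countable_left (f := fun p : Ω × ℕ => Y (g k p.2) p.1)
      fun j => hYm (g k j)).comp (measurable_id.prodMk (hN k))
  have hbound : ∀ k, ∫⁻ ω in A, ENNReal.ofReal (Y (g k (N k ω)) ω) ∂μ ≤
      ∫⁻ ω in A, w (ρ ω) * ENNReal.ofReal (Y T ω) ∂μ := by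
    intro k
    -- As `w` is antitone and rounding goes up, the weight at the rounded time is at most the weight
    -- at `ρ`.
    exact setLIntegral_comp_le_of_countable hYm hset (hgT k) (hNeq_meas k)
      (fun ω => hw (hle k ω)) hA
  calc ∫⁻ ω in A, ENNReal.ofReal (Y (ρ ω) ω) ∂μ
      = ∫⁻ ω in A, liminf (fun k => ENNReal.ofReal (Y (g k (N k ω)) ω)) atTop ∂μ := by
        refine lintegral_congr fun ω => (Tendsto.liminf_eq ?_).symm
        refine ENNReal.tendsto_ofReal ?_
        exact (hrc ω (ρ ω)).tendsto.comp
          (tendsto_nhdsWithin_iff.2 ⟨hlim ω, Eventually.of_forall fun k => hle k ω⟩)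
    _ ≤ liminf (fun k => ∫⁻ ω in A, ENNReal.ofReal (Y (g k (N k ω)) ω) ∂μ) atTop :=
        lintegral_liminf_le fun k => (hY_meas k).ennreal_ofReal
    _ ≤ _ := liminf_le_of_le (by isBoundedDefault) fun b hb => by
        obtain ⟨k, hk⟩ := hb.exists
        exact hk.trans (hbound k)

lemma eventually_lt_of_tendsto_top {τ : ℕ → WithTop ℝ≥0} (h : Tendsto τ atTop (𝓝 ⊤)) (t : ℝ≥0) :
    ∀ᶠ n in atTop, (t : WithTop ℝ≥0) < τ n :=
  h.eventually (lt_mem_nhds (WithTop.coe_lt_top t))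

lemma bot_lt_of_coe_lt {t : ℝ≥0} {τ : WithTop ℝ≥0} (h : (t : WithTop ℝ≥0) < τ) : ⊥ < τ :=
  bot_le.trans_lt h

/-- A nonnegative local martingale has decreasing expectations. -/
lemma IsLocalMartingale.lintegral_le [IsProbabilityMeasure μ] (h : IsLocalMartingale 𝒢 μ Y)
    (hnn : ∀ t ω, 0 ≤ Y t ω) (t : ℝ≥0) :
    ∫⁻ ω, ENNReal.ofReal (Y t ω) ∂μ ≤ ∫⁻ ω, ENNReal.ofReal (Y 0 ω) ∂μ := by
  obtain ⟨τ, hτ, hM⟩ := h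
  set Z : ℕ → ℝ≥0 → Ω → ℝ := fun n =>
    stoppedProcess (fun i => {ω | ⊥ < τ n ω}.indicator (Y i)) (τ n) with hZ
  have hZnn : ∀ n t ω, 0 ≤ Z n t ω := fun n t ω =>
    Set.indicator_nonneg (fun ω _ => hnn _ ω) ω
  have hZm : ∀ n t, Measurable (Z n t) := fun n t =>
    (((hM n).1.stronglyMeasurable t).mono (𝒢.le t)).measurable
  -- Localisation kills the process on `{τ n = ⊥}`, so the stopped process may start below `Y`.
  have hZ0 : ∀ n ω, Z n 0 ω ≤ Y 0 ω := fun n ω => by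
    have : Z n 0 ω = {ω | ⊥ < τ n ω}.indicator (Y 0) ω := by
      have h0 : ((0 : ℝ≥0) : WithTop ℝ≥0) ≤ τ n ω := by
        rw [← bot_eq_zero, WithTop.coe_bot]; exact bot_le
      exact stoppedProcess_eq_of_le h0
    rw [this]
    exact Set.indicator_le_self' (fun _ _ => hnn 0 ω) ω
  calc ∫⁻ ω, ENNReal.ofReal (Y t ω) ∂μ
      = ∫⁻ ω, liminf (fun n => ENNReal.ofReal (Z n t ω)) atTop ∂μ := by
        refine lintegral_congr_ae ?_
        filter_upwards [hτ.tendsto_top] with ω hω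
        refine (Tendsto.liminf_eq (tendsto_const_nhds.congr' ?_)).symm
        filter_upwards [eventually_lt_of_tendsto_top hω t] with n hn
        have h1 : Z n t ω = {ω | ⊥ < τ n ω}.indicator (Y t) ω := stoppedProcess_eq_of_le hn.le
        rw [h1, Set.indicator_of_mem (show ω ∈ {ω | ⊥ < τ n ω} from bot_lt_of_coe_lt hn)]
    _ ≤ liminf (fun n => ∫⁻ ω, ENNReal.ofReal (Z n t ω) ∂μ) atTop :=
        lintegral_liminf_le fun n => (hZm n t).ennreal_ofReal
    _ ≤ _ := liminf_le_of_le (by isBoundedDefault) fun b hb => by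
        obtain ⟨n, hn⟩ := hb.exists
        rw [lintegral_martingale_eq (hM n).1 (hZnn n) t] at hn
        exact hn.trans (lintegral_mono fun ω => ENNReal.ofReal_le_ofReal (hZ0 n ω))

/-- If a nonnegative local martingale is the product of a decreasing deterministic factor `w` and
a martingale on `[0, T]`, then its expectation at time `0` is at most `w T` times that at `T`. -/
lemma IsLocalMartingale.lintegral_zero_le [IsProbabilityMeasure μ]
    (h : IsLocalMartingale 𝒢 μ Y) (hnn : ∀ t ω, 0 ≤ Y t ω) (hYm : ∀ t, Measurable (Y t))
    (hrc : ∀ ω t, ContinuousWithinAt (fun t => Y t ω) (Set.Ici t) t)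
    {T : ℝ≥0} {w : ℝ≥0 → ℝ≥0∞} (hw : Antitone w) (hw0 : w 0 ≠ ⊤)
    (hfin : ∫⁻ ω, ENNReal.ofReal (Y T ω) ∂μ ≠ ⊤)
    (hset : ∀ s ≤ T, ∀ A, MeasurableSet[𝒢 s] A →
      ∫⁻ ω in A, ENNReal.ofReal (Y s ω) ∂μ = w s * ∫⁻ ω in A, ENNReal.ofReal (Y T ω) ∂μ) :
    ∫⁻ ω, ENNReal.ofReal (Y 0 ω) ∂μ ≤ w T * ∫⁻ ω, ENNReal.ofReal (Y T ω) ∂μ := by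
  obtain ⟨τ, hτ, hM⟩ := h
  let A : ℕ → Set Ω := fun n => {ω | ⊥ < τ n ω}
  -- The minimum with `T` is never `⊤`, so the default value of `untopA` plays no role.
  let ρ : ℕ → Ω → ℝ≥0 := fun n ω => (min (T : WithTop ℝ≥0) (τ n ω)).untopA
  have hA : ∀ n, MeasurableSet[𝒢 0] (A n) := by
    intro n
    have : A n = {ω | τ n ω ≤ ((0 : ℝ≥0) : WithTop ℝ≥0)}ᶜ := by
      ext ω
      rw [← bot_eq_zero, WithTop.coe_bot]
      simp [A, pos_iff_ne_zero]
    rw [this]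
    exact @MeasurableSet.compl Ω _ (𝒢 0) (hτ.isStoppingTime n 0)
  have hne : ∀ n ω, min (T : WithTop ℝ≥0) (τ n ω) ≠ ⊤ := fun n ω =>
    ((min_le_left _ _).trans_lt (WithTop.coe_lt_top T)).ne
  have hρc : ∀ n ω, (ρ n ω : WithTop ℝ≥0) = min (T : WithTop ℝ≥0) (τ n ω) := fun n ω => by
    simp only [ρ, WithTop.untopA_eq_untop (hne n ω), WithTop.coe_untop]
  have hρT : ∀ n ω, ρ n ω ≤ T := fun n ω => by
    rw [← WithTop.coe_le_coe, hρc]; exact min_le_left _ _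
  have hρs : ∀ n s, MeasurableSet[𝒢 s] {ω | ρ n ω ≤ s} := by
    intro n s
    rcases le_or_gt T s with hs | hs
    · have : {ω | ρ n ω ≤ s} = Set.univ := by
        ext ω; simpa using (hρT n ω).trans hs
      rw [this]
      exact @MeasurableSet.univ Ω (𝒢 s)
    · have : {ω | ρ n ω ≤ s} = {ω | τ n ω ≤ s} := by
        ext ω
        simp only [Set.mem_ofPred_eq]
        rw [← WithTop.coe_le_coe, hρc, min_le_iff, WithTop.coe_le_coe]
        simp [hs]
      rw [this]
      exact hτ.isStoppingTime n s
  have hρm : ∀ n, Measurable (ρ n) := fun n =>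
    measurable_of_Iic fun s => 𝒢.le s _ (hρs n s)
  have hkey : ∀ n, ∫⁻ ω, (A n).indicator (fun ω => ENNReal.ofReal (Y 0 ω)) ω ∂μ ≤
      ∫⁻ ω, w (ρ n ω) * ENNReal.ofReal (Y T ω) ∂μ := by
    intro n
    have hZnn : ∀ t ω, 0 ≤ stoppedProcess (fun i => (A n).indicator (Y i)) (τ n) t ω :=
      fun t ω => Set.indicator_nonneg (fun ω _ => hnn _ ω) ω
    have hmart := lintegral_martingale_eq (hM n).1 hZnn T
    have hind : ∀ (f : Ω → ℝ) ω, ENNReal.ofReal ((A n).indicator f ω) =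
        (A n).indicator (fun ω => ENNReal.ofReal (f ω)) ω := fun f ω => by
      by_cases hω : ω ∈ A n <;> simp [hω]
    have h0 : ∀ ω, ((0 : ℝ≥0) : WithTop ℝ≥0) ≤ τ n ω := fun ω => by
      rw [← bot_eq_zero, WithTop.coe_bot]; exact bot_le
    have e0 : ∀ ω, stoppedProcess (fun i => (A n).indicator (Y i)) (τ n) 0 ω =
        (A n).indicator (Y 0) ω := fun ω => stoppedProcess_eq_of_le (h0 ω)
    have eT : ∀ ω, stoppedProcess (fun i => (A n).indicator (Y i)) (τ n) T ω =
        (A n).indicator (fun ω => Y (ρ n ω) ω) ω := fun ω => by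
      by_cases hω : ω ∈ A n <;> simp [stoppedProcess, hω, ρ]
    change ∫⁻ ω, ENNReal.ofReal (stoppedProcess (fun i => (A n).indicator (Y i)) (τ n) T ω) ∂μ =
      ∫⁻ ω, ENNReal.ofReal (stoppedProcess (fun i => (A n).indicator (Y i)) (τ n) 0 ω) ∂μ
      at hmart
    simp_rw [e0, eT, hind] at hmart
    rw [← hmart, lintegral_indicator (𝒢.le 0 _ (hA n))]
    exact (setLIntegral_comp_le hw hYm hrc hset (hρs n) (hρT n) (hA n)).trans
      (setLIntegral_le_lintegral _ _)
  -- The weights are at most `w 0`, so the integrable function `w 0 * Y T` dominates. This replaces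
  -- uniform integrability of the stopped values; eventually `ρ n ω = T`.
  have hlim : Tendsto (fun n => ∫⁻ ω, w (ρ n ω) * ENNReal.ofReal (Y T ω) ∂μ) atTop
      (𝓝 (∫⁻ ω, w T * ENNReal.ofReal (Y T ω) ∂μ)) := by
    refine tendsto_lintegral_of_dominated_convergence
      (fun ω => w 0 * ENNReal.ofReal (Y T ω))
      (fun n => (hw.measurable.comp (hρm n)).mul (hYm T).ennreal_ofReal)
      (fun n => Eventually.of_forall fun ω => ?_) ?_ ?_
    · dsimp only
      gcongr
      exact hw zero_le
    · rw [lintegral_const_mul _ (hYm T).ennreal_ofReal]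
      exact ENNReal.mul_ne_top hw0 hfin
    · filter_upwards [hτ.tendsto_top] with ω hω
      refine tendsto_const_nhds.congr' ?_
      filter_upwards [eventually_lt_of_tendsto_top hω T] with n hn
      have : ρ n ω = T := by
        rw [← WithTop.coe_inj, hρc, min_eq_left hn.le]
      rw [this]
  rw [← lintegral_const_mul _ (hYm T).ennreal_ofReal]
  calc ∫⁻ ω, ENNReal.ofReal (Y 0 ω) ∂μ
      = ∫⁻ ω, liminf (fun n => (A n).indicator (fun ω => ENNReal.ofReal (Y 0 ω)) ω) atTop ∂μ := by
        refine lintegral_congr_ae ?_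
        filter_upwards [hτ.tendsto_top] with ω hω
        refine (Tendsto.liminf_eq (tendsto_const_nhds.congr' ?_)).symm
        filter_upwards [eventually_lt_of_tendsto_top hω 0] with n hn
        rw [Set.indicator_of_mem (show ω ∈ A n from bot_lt_of_coe_lt hn)]
    _ ≤ liminf (fun n => ∫⁻ ω, (A n).indicator (fun ω => ENNReal.ofReal (Y 0 ω)) ω ∂μ) atTop :=
        lintegral_liminf_le fun n => (hYm 0).ennreal_ofReal.indicator (𝒢.le 0 _ (hA n))
    _ ≤ liminf (fun n => ∫⁻ ω, w (ρ n ω) * ENNReal.ofReal (Y T ω) ∂μ) atTop :=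
        liminf_le_liminf (Eventually.of_forall hkey)
    _ = _ := hlim.liminf_eq

end Martingale

/-! ### The Esscher transform -/

section Esscher

variable {Ω : Type*} {m : MeasurableSpace Ω} {ℱ : Filtration ℝ≥0 m} {P : Measure Ω}
  {X : ℝ≥0 → Ω → ℝ} {ap lp am lm Θ : ℝ}

lemma measurable_indicator_one {Ω : Type*} {m : MeasurableSpace Ω} {A : Set Ω}
    (hA : MeasurableSet A) : Measurable (A.indicator (1 : Ω → ℝ≥0∞)) :=
  measurable_one.indicator hA

/-- The density of the Esscher transform on `ℱ t`. -/
noncomputable def esscherDensity (P : Measure Ω) (X : ℝ≥0 → Ω → ℝ) (Θ : ℝ) (t : ℝ≥0) (ω : Ω) :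
    ℝ≥0∞ :=
  ENNReal.ofReal (Real.exp (Θ * X t ω - cgf (X 1) P Θ * t))

lemma IsLevyProcess.measurable_esscherDensity (hX : IsLevyProcess ℱ P X) (Θ : ℝ) (t : ℝ≥0) :
    Measurable[ℱ t] (esscherDensity P X Θ t) :=
  (((hX.adapted t).const_mul Θ).sub_const _).exp.ennreal_ofReal

lemma IsLevyProcess.lintegral_esscher (hX : IsLevyProcess ℱ P X) (Θ : ℝ) {t : ℝ≥0}
    {f : Ω → ℝ≥0∞} (hf : Measurable[ℱ t] f) :
    ∫⁻ ω, f ω ∂(esscher ℱ P X Θ t) = ∫⁻ ω, f ω * esscherDensity P X Θ t ω ∂P := by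
  have hd := hX.measurable_esscherDensity Θ t
  have h1 := @lintegral_withDensity_eq_lintegral_mul Ω (ℱ t) (P.trim (ℱ.le t)) _ hd _ hf
  have h2 := lintegral_trim (μ := P) (ℱ.le t) (hd.mul hf)
  refine (h1.trans h2).trans (lintegral_congr fun ω => ?_)
  exact mul_comm _ _

lemma IsLevyProcess.esscher_apply (hX : IsLevyProcess ℱ P X) (Θ : ℝ) {t : ℝ≥0}
    {A : Set Ω} (hA : MeasurableSet[ℱ t] A) :
    esscher ℱ P X Θ t A = ∫⁻ ω in A, esscherDensity P X Θ t ω ∂P := by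
  have h := hX.lintegral_esscher Θ (f := A.indicator 1) (measurable_indicator_one hA)
  rw [@lintegral_indicator_one Ω (ℱ t) _ _ hA] at h
  rw [h, ← lintegral_indicator (ℱ.le t _ hA)]
  refine lintegral_congr fun ω => ?_
  by_cases hω : ω ∈ A <;> simp [hω]

/-- The density at `t` is the density at `s` times a function of the increment alone. Consistency,
independence and stationarity under the transform all follow from this. The integrals stay under
`P`, which avoids comparing measures on different σ-algebras. -/
lemma IsLevyProcess.lintegral_mul_increment_esscher (hX : IsLevyProcess ℱ P X) (Θ : ℝ)
    {s t : ℝ≥0} (hst : s ≤ t) {f : Ω → ℝ≥0∞} (hf : Measurable[ℱ s] f) {g : ℝ → ℝ≥0∞}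
    (hg : Measurable g) :
    ∫⁻ ω, f ω * g (X t ω - X s ω) * esscherDensity P X Θ t ω ∂P =
      (∫⁻ ω, f ω * esscherDensity P X Θ s ω ∂P) *
        ∫⁻ ω, g (X (t - s) ω) * esscherDensity P X Θ (t - s) ω ∂P := by
  have h := hX.lintegral_mul_increment hst (hf.mul (hX.measurable_esscherDensity Θ s))
    (g := fun x => g x * ENNReal.ofReal (Real.exp (Θ * x - cgf (X 1) P Θ * (t - s : ℝ≥0))))
    (by fun_prop)
  refine Eq.trans (lintegral_congr fun ω => ?_) h
  have : esscherDensity P X Θ t ω = esscherDensity P X Θ s ω *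
      ENNReal.ofReal (Real.exp (Θ * (X t ω - X s ω) - cgf (X 1) P Θ * (t - s : ℝ≥0))) := by
    rw [esscherDensity, esscherDensity, ← ENNReal.ofReal_mul (Real.exp_nonneg _), ← Real.exp_add,
      NNReal.coe_sub hst]
    ring_nf
  rw [this, Pi.mul_apply]
  ring

lemma esscherDensity_mul_exp (θ : ℝ) (t : ℝ≥0) (ω : Ω) :
    ENNReal.ofReal (Real.exp (θ * X t ω)) * esscherDensity P X Θ t ω =
      ENNReal.ofReal (Real.exp (-(cgf (X 1) P Θ * t))) *
        ENNReal.ofReal (Real.exp ((Θ + θ) * X t ω)) := by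
  rw [esscherDensity, ← ENNReal.ofReal_mul (Real.exp_nonneg _),
    ← ENNReal.ofReal_mul (Real.exp_nonneg _), ← Real.exp_add, ← Real.exp_add]
  ring_nf

lemma IsLevyProcess.lintegral_exp_mul_esscherDensity (hX : IsLevyProcess ℱ P X) (θ : ℝ)
    (t : ℝ≥0) :
    ∫⁻ ω, ENNReal.ofReal (Real.exp (θ * X t ω)) * esscherDensity P X Θ t ω ∂P =
      ENNReal.ofReal (Real.exp (-(cgf (X 1) P Θ * t))) * expMoment P X (Θ + θ) t := by
  simp_rw [esscherDensity_mul_exp]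
  exact lintegral_const_mul _ ((hX.measurable t).const_mul _).exp.ennreal_ofReal

lemma IsBilateralGammaProcess.expMoment_one (hX : IsBilateralGammaProcess ℱ P X ap lp am lm)
    (θ : ℝ) : expMoment P X θ 1 =
      ∫⁻ x, ENNReal.ofReal (Real.exp (θ * x)) ∂bilateralGamma ap lp am lm := by
  rw [← hX.law_one, lintegral_map (by fun_prop) (hX.measurable 1)]
  rfl

section Moments

variable (hX : IsBilateralGammaProcess ℱ P X ap lp am lm)
  (hap : 0 < ap) (hlp : 0 < lp) (ham : 0 < am) (hlm : 0 < lm)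

include hX hap hlp ham hlm

lemma IsBilateralGammaProcess.exp_cgf {θ : ℝ} (hθ : θ ∈ Set.Ioo (-lm) lp) :
    Real.exp (cgf (X 1) P θ) = bilateralMGF ap lp am lm θ := by
  have hpos := bilateralMGF_pos (ap := ap) (am := am) hlp hlm hθ
  have hmgf : mgf (X 1) P θ = bilateralMGF ap lp am lm θ := by
    have h1 := hX.expMoment_one θ
    rw [lintegral_exp_bilateralGamma hap hlp ham hlm hθ, expMoment] at h1
    rw [mgf, integral_eq_lintegral_of_nonneg_ae
      (Eventually.of_forall fun ω => Real.exp_nonneg _)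
      ((hX.measurable 1).const_mul θ).exp.aestronglyMeasurable, h1,
      ENNReal.toReal_ofReal hpos.le]
  rw [cgf, hmgf, Real.exp_log hpos]

variable [IsProbabilityMeasure P]

lemma IsBilateralGammaProcess.expMoment_eq {θ : ℝ} (hθ : θ ∈ Set.Ioo (-lm) lp) (t : ℝ≥0) :
    expMoment P X θ t = ENNReal.ofReal (Real.exp (t * cgf (X 1) P θ)) := by
  refine hX.expMoment_eq_exp ?_ t
  rw [hX.expMoment_one, lintegral_exp_bilateralGamma hap hlp ham hlm hθ,
    hX.exp_cgf hap hlp ham hlm hθ]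

lemma IsBilateralGammaProcess.lintegral_esscherDensity (hΘ : Θ ∈ Set.Ioo (-lm) lp) (t : ℝ≥0) :
    ∫⁻ ω, esscherDensity P X Θ t ω ∂P = 1 := by
  have h := hX.lintegral_exp_mul_esscherDensity (Θ := Θ) 0 t
  simp only [zero_mul, Real.exp_zero, ENNReal.ofReal_one, one_mul, add_zero] at h
  rw [h, hX.expMoment_eq hap hlp ham hlm hΘ, ← ENNReal.ofReal_mul (Real.exp_nonneg _),
    ← Real.exp_add, mul_comm, neg_add_cancel, Real.exp_zero, ENNReal.ofReal_one]

lemma IsBilateralGammaProcess.setLIntegral_esscherDensity (hΘ : Θ ∈ Set.Ioo (-lm) lp)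
    {s t : ℝ≥0} (hst : s ≤ t) {f : Ω → ℝ≥0∞} (hf : Measurable[ℱ s] f) :
    ∫⁻ ω, f ω * esscherDensity P X Θ t ω ∂P = ∫⁻ ω, f ω * esscherDensity P X Θ s ω ∂P := by
  have h := hX.lintegral_mul_increment_esscher Θ hst hf (g := fun _ => 1) measurable_const
  simpa [hX.lintegral_esscherDensity hap hlp ham hlm hΘ] using h

lemma IsBilateralGammaProcess.isLocallyEquivalent_esscher (hΘ : Θ ∈ Set.Ioo (-lm) lp) :
    IsLocallyEquivalent ℱ P (esscher ℱ P X Θ) where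
  prob t := by
    refine @IsProbabilityMeasure.mk Ω (ℱ t) _ ?_
    rw [hX.esscher_apply Θ (@MeasurableSet.univ Ω (ℱ t)), setLIntegral_univ,
      hX.lintegral_esscherDensity hap hlp ham hlm hΘ]
  consistent s t h := by
    refine @Measure.ext Ω (ℱ s) _ _ fun A hA => ?_
    rw [trim_measurableSet_eq _ hA]
    have hf : Measurable[ℱ s] (A.indicator (1 : Ω → ℝ≥0∞)) := measurable_indicator_one hA
    have e := hX.setLIntegral_esscherDensity hap hlp ham hlm hΘ h hf
    rw [← hX.lintegral_esscher Θ hf, ← hX.lintegral_esscher Θ (hf.mono (ℱ.mono h) le_rfl),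
      @lintegral_indicator_one Ω (ℱ t) _ _ (ℱ.mono h _ hA),
      @lintegral_indicator_one Ω (ℱ s) _ _ hA] at e
    exact e
  ac t := @withDensity_absolutelyContinuous Ω (ℱ t) _ _
  ac' t := by
    refine @withDensity_absolutelyContinuous' Ω (ℱ t) _ _ ?_ ?_
    · exact (hX.measurable_esscherDensity Θ t).aemeasurable
    · exact Eventually.of_forall fun ω => by simp [Real.exp_pos]

end Moments

end Esscher

/-! ### The law of the process under the Esscher transform -/

section Law

variable {Ω : Type*} {m : MeasurableSpace Ω} {ℱ : Filtration ℝ≥0 m} {P : Measure Ω}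
  {X : ℝ≥0 → Ω → ℝ} {ap lp am lm Θ : ℝ}

lemma IsLevyProcess.esscher_preimage (hX : IsLevyProcess ℱ P X) (Θ : ℝ) {t : ℝ≥0}
    {Z : Ω → ℝ} (hZ : Measurable[ℱ t] Z) {B : Set ℝ} (hB : MeasurableSet B) :
    esscher ℱ P X Θ t (Z ⁻¹' B) =
      ∫⁻ ω, B.indicator 1 (Z ω) * esscherDensity P X Θ t ω ∂P := by
  rw [hX.esscher_apply Θ (hZ hB), ← lintegral_indicator (ℱ.le t _ (hZ hB))]
  refine lintegral_congr fun ω => ?_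
  by_cases hω : Z ω ∈ B <;> simp [hω]

variable [IsProbabilityMeasure P]

lemma IsBilateralGammaProcess.isBilateralGammaProcessUnder_esscher
    (hX : IsBilateralGammaProcess ℱ P X ap lp am lm)
    (hap : 0 < ap) (hlp : 0 < lp) (ham : 0 < am) (hlm : 0 < lm) (hΘ : Θ ∈ Set.Ioo (-lm) lp) :
    IsBilateralGammaProcessUnder ℱ (esscher ℱ P X Θ) X ap (lp - Θ) am (lm + Θ) := by
  have hloc := hX.isLocallyEquivalent_esscher hap hlp ham hlm hΘ
  have hinc : ∀ s t, s ≤ t → Measurable[ℱ t] (X t - X s) := fun s t hst =>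
    (hX.adapted t).sub ((hX.adapted s).mono (ℱ.mono hst) le_rfl)
  have hB1 : ∀ {B : Set ℝ}, MeasurableSet B → Measurable (B.indicator (1 : ℝ → ℝ≥0∞)) :=
    fun hB => measurable_indicator_one hB
  have hinc_law : ∀ s t, s ≤ t → ∀ B, MeasurableSet B →
      esscher ℱ P X Θ t ((X t - X s) ⁻¹' B) =
        esscher ℱ P X Θ (t - s) (X (t - s) ⁻¹' B) := fun s t hst B hB => by
    rw [hX.esscher_preimage Θ (hinc s t hst) hB, hX.esscher_preimage Θ (hX.adapted _) hB]
    have h := hX.lintegral_mul_increment_esscher Θ hst (f := fun _ => 1) measurable_const (hB1 hB)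
    simpa [hX.lintegral_esscherDensity hap hlp ham hlm hΘ] using h
  refine ⟨⟨hX.adapted, hX.cadlag, ?_, ?_, ?_⟩, ?_⟩
  · refine (hloc.ac 0).ae_le ?_
    have hm : MeasurableSet[ℱ 0] {ω | X 0 ω = 0} := hX.adapted 0 (measurableSet_singleton 0)
    exact (ae_iff.2 ((trim_measurableSet_eq (ℱ.le 0)
      (@MeasurableSet.compl Ω _ (ℱ 0) hm)).trans (ae_iff.1 hX.zero)))
  · intro s t hst
    rw [Indep_iff]
    rintro _ A ⟨B, hB, rfl⟩ hA
    have hA' : MeasurableSet[ℱ t] A := ℱ.mono hst _ hA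
    have hset : ∀ u, MeasurableSet[ℱ u] A → esscher ℱ P X Θ u A =
        ∫⁻ ω, A.indicator 1 ω * esscherDensity P X Θ u ω ∂P := fun u hu => by
      rw [← hX.lintegral_esscher Θ (measurable_indicator_one hu),
        @lintegral_indicator_one Ω (ℱ u) _ _ hu]
    have hAs : esscher ℱ P X Θ t A = esscher ℱ P X Θ s A := by
      rw [hset t hA', hset s hA, hX.setLIntegral_esscherDensity hap hlp ham hlm hΘ hst
        (measurable_indicator_one hA)]
    rw [hAs, hinc_law s t hst B hB, hX.esscher_preimage Θ (hX.adapted _) hB, hset s hA,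
      mul_comm, ← hX.lintegral_mul_increment_esscher Θ hst (measurable_indicator_one hA) (hB1 hB),
      hX.esscher_apply Θ (@MeasurableSet.inter Ω (ℱ t) _ _ (hinc s t hst hB) hA'),
      ← lintegral_indicator (ℱ.le t _ (@MeasurableSet.inter Ω (ℱ t) _ _ (hinc s t hst hB) hA'))]
    refine lintegral_congr fun ω => ?_
    by_cases h1 : X t ω - X s ω ∈ B <;> by_cases h2 : ω ∈ A <;> simp [h1, h2]
  · intro s t hst
    refine Measure.ext fun B hB => ?_
    rw [@Measure.map_apply Ω ℝ (ℱ t) _ _ _ (hinc s t hst) _ hB,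
      @Measure.map_apply Ω ℝ (ℱ (t - s)) _ _ _ (hX.adapted _) _ hB]
    exact hinc_law s t hst B hB
  · refine Measure.ext fun B hB => ?_
    rw [@Measure.map_apply Ω ℝ (ℱ 1) _ _ _ (hX.adapted _) _ hB,
      hX.esscher_apply Θ (hX.adapted 1 hB)]
    -- At time `1` the density is exactly the normalised tilt, so the law of `X 1` follows from
    -- `bilateralGamma_withDensity_exp`.
    have e : ∀ ω, esscherDensity P X Θ 1 ω = ENNReal.ofReal (bilateralMGF ap lp am lm Θ)⁻¹ *
        ENNReal.ofReal (Real.exp (Θ * X 1 ω)) := fun ω => by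
      rw [esscherDensity, ← hX.exp_cgf hap hlp ham hlm hΘ, ← Real.exp_neg,
        ← ENNReal.ofReal_mul (Real.exp_nonneg _), ← Real.exp_add]
      simp [sub_eq_neg_add]
    have hpos := bilateralMGF_pos (ap := ap) (am := am) hlp hlm hΘ
    simp_rw [e]
    rw [lintegral_const_mul _ ((hX.measurable 1).const_mul _).exp.ennreal_ofReal,
      ← setLIntegral_map (f := fun x => ENNReal.ofReal (Real.exp (Θ * x))) hB (by fun_prop)
        (hX.measurable 1), hX.law_one, ← withDensity_apply _ hB,
      bilateralGamma_withDensity_exp hap hlp ham hlm hΘ, Measure.smul_apply, smul_eq_mul,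
      ← mul_assoc, ← ENNReal.ofReal_mul (inv_nonneg.2 hpos.le), inv_mul_cancel₀ hpos.ne',
      ENNReal.ofReal_one, one_mul]

/-- Each clause of the definition involves events of one `ℱ t`, on which `ν` and `Q t` agree. -/
lemma IsBilateralGammaProcessUnder.of_trim {Q : ∀ t : ℝ≥0, Measure[ℱ t] Ω} {ν : Measure Ω}
    (hQ : ∀ t, ν.trim (ℱ.le t) = Q t) (h : IsBilateralGammaProcessUnder ℱ Q X ap lp am lm) :
    IsBilateralGammaProcess ℱ ν X ap lp am lm := by
  have happ : ∀ t A, MeasurableSet[ℱ t] A → ν A = Q t A := fun t A hA => by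
    rw [← hQ t, trim_measurableSet_eq _ hA]
  have hinc : ∀ s t, s ≤ t → Measurable[ℱ t] (X t - X s) := fun s t hst =>
    (h.adapted t).sub ((h.adapted s).mono (ℱ.mono hst) le_rfl)
  have hm : ∀ t, Measurable (X t) := fun t => (h.adapted t).mono (ℱ.le t) le_rfl
  refine ⟨⟨h.adapted, h.cadlag, ?_, ?_, ?_⟩, ?_⟩
  · refine ae_of_ae_trim (ℱ.le 0) ?_
    rw [hQ 0]
    exact h.zero
  · intro s t hst
    have hi := h.indep s t hst
    rw [Indep_iff] at hi ⊢
    rintro _ A ⟨B, hB, rfl⟩ hA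
    have hA' := ℱ.mono hst _ hA
    have hB' := hinc s t hst hB
    rw [happ t _ (@MeasurableSet.inter Ω (ℱ t) _ _ hB' hA'), happ t _ hA', happ t _ hB']
    exact hi _ A ⟨B, hB, rfl⟩ hA
  · intro s t hst
    refine Measure.ext fun B hB => ?_
    have := congrArg (fun μ => μ B) (h.stationary s t hst)
    rw [@Measure.map_apply Ω ℝ (ℱ t) _ _ _ (hinc s t hst) _ hB,
      @Measure.map_apply Ω ℝ (ℱ (t - s)) _ _ _ (h.adapted _) _ hB] at this
    rw [Measure.map_apply ((hm t).sub (hm s)) hB, Measure.map_apply (hm _) hB,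
      happ t _ (hinc s t hst hB), happ (t - s) _ (h.adapted _ hB), this]
  · rw [← h.law_one]
    refine Measure.ext fun B hB => ?_
    rw [Measure.map_apply (hm 1) hB, @Measure.map_apply Ω ℝ (ℱ 1) _ _ _ (h.adapted _) _ hB,
      happ 1 _ (h.adapted 1 hB)]

end Law

/-! ### The discounted price under the Esscher transform -/

section Price

variable {Ω : Type*} {m : MeasurableSpace Ω} {ℱ : Filtration ℝ≥0 m} {P : Measure Ω}
  {X : ℝ≥0 → Ω → ℝ} {ap lp am lm Θ S₀ r q : ℝ}

lemma discountedPrice_pos (hS₀ : 0 < S₀) (t : ℝ≥0) (ω : Ω) :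
    0 < discountedPrice S₀ r q X t ω := by
  unfold discountedPrice
  positivity

lemma IsLevyProcess.measurable_discountedPrice (hX : IsLevyProcess ℱ P X) (t : ℝ≥0) :
    Measurable[ℱ t] (discountedPrice S₀ r q X t) :=
  ((hX.adapted t).exp.const_mul S₀).const_mul _

lemma IsCadlagPath.discountedPrice {ω : Ω} (h : IsCadlagPath fun t => X t ω) :
    IsCadlagPath fun t => discountedPrice S₀ r q X t ω := by
  have hc : Continuous fun t : ℝ≥0 => Real.exp (-(r - q) * t) := by fun_prop
  intro t
  refine ⟨?_, ?_⟩
  · exact hc.continuousWithinAt.mul (continuousWithinAt_const.mul (h t).1.rexp)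
  · obtain ⟨l, hl⟩ := (h t).2
    exact ⟨_, ((hc.tendsto t).mono_left nhdsWithin_le_nhds).mul
      (tendsto_const_nhds.mul hl.rexp)⟩

lemma IsCadlagPath.comp_min {x : ℝ≥0 → ℝ} (h : IsCadlagPath x) (T : ℝ≥0) :
    IsCadlagPath fun t => x (min t T) := by
  intro t
  have hmin : Continuous fun t : ℝ≥0 => min t T := by fun_prop
  refine ⟨?_, ?_⟩
  · have h1 := (h (min t T)).1
    exact h1.comp (f := fun u => min u T) hmin.continuousWithinAt
      fun u hu => min_le_min_right T (Set.mem_Ici.1 hu)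
  · rcases le_or_gt t T with htT | htT
    · obtain ⟨l, hl⟩ := (h t).2
      refine ⟨l, hl.congr' ?_⟩
      filter_upwards [self_mem_nhdsWithin] with u hu
      rw [min_eq_left ((le_of_lt hu).trans htT)]
    · refine ⟨x T, tendsto_const_nhds.congr' ?_⟩
      filter_upwards [nhdsWithin_le_nhds (lt_mem_nhds htT)] with u hu
      rw [min_eq_right (le_of_lt hu)]

/-- The exponential growth rate of the discounted price under the Esscher transform. -/
noncomputable def drift (P : Measure Ω) (X : ℝ≥0 → Ω → ℝ) (r q Θ : ℝ) : ℝ :=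
  cgf (X 1) P (Θ + 1) - cgf (X 1) P Θ - (r - q)

lemma IsBilateralGammaProcess.drift_eq_zero_iff
    (hX : IsBilateralGammaProcess ℱ P X ap lp am lm) (hap : 0 < ap) (hlp : 0 < lp)
    (ham : 0 < am) (hlm : 0 < lm) (hΘ : Θ ∈ Set.Ioo (-lm) (lp - 1)) :
    drift P X r q Θ = 0 ↔ EsscherEquation ap lp am lm r q Θ := by
  have h1 : Θ ∈ Set.Ioo (-lm) lp := ⟨hΘ.1, by linarith [hΘ.2]⟩
  have h2 : Θ + 1 ∈ Set.Ioo (-lm) lp := ⟨by linarith [hΘ.1], by linarith [hΘ.2]⟩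
  have hpos := bilateralMGF_pos (ap := ap) (am := am) hlp hlm h1
  have h : Real.exp (cgf (X 1) P (Θ + 1) - cgf (X 1) P Θ) = esscherRatio ap lp am lm Θ := by
    rw [Real.exp_sub, hX.exp_cgf hap hlp ham hlm h1, hX.exp_cgf hap hlp ham hlm h2,
      bilateralMGF_add_one hlp hlm hΘ, mul_div_assoc, div_self hpos.ne', mul_one]
  rw [drift, sub_eq_zero, ← Real.exp_eq_exp, h]
  rfl

/-- The price at `t` is the price at `s` times the discount and the exponential of the increment,
whose transformed moment is `exp ((Ψ(Θ+1) - Ψ(Θ)) (t - s))`. The restriction `Θ < lp - 1` keeps `Θ +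
1` in the domain of `Ψ`. -/
lemma IsBilateralGammaProcess.lintegral_price [IsProbabilityMeasure P]
    (hX : IsBilateralGammaProcess ℱ P X ap lp am lm) (hap : 0 < ap) (hlp : 0 < lp)
    (ham : 0 < am) (hlm : 0 < lm) (hS₀ : 0 < S₀) (hΘ : Θ ∈ Set.Ioo (-lm) (lp - 1))
    {s t : ℝ≥0} (hst : s ≤ t) {f : Ω → ℝ≥0∞} (hf : Measurable[ℱ s] f) :
    ∫⁻ ω, f ω * ENNReal.ofReal (discountedPrice S₀ r q X t ω) * esscherDensity P X Θ t ω ∂P =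
      ENNReal.ofReal (Real.exp (drift P X r q Θ * (t - s : ℝ≥0))) *
        ∫⁻ ω, f ω * ENNReal.ofReal (discountedPrice S₀ r q X s ω) *
          esscherDensity P X Θ s ω ∂P := by
  have h2 : Θ + 1 ∈ Set.Ioo (-lm) lp := ⟨by linarith [hΘ.1], by linarith [hΘ.2]⟩
  have hf' : Measurable[ℱ s] fun ω => f ω * ENNReal.ofReal (discountedPrice S₀ r q X s ω) :=
    hf.mul (hX.measurable_discountedPrice s).ennreal_ofReal
  have key := hX.lintegral_mul_increment_esscher Θ hst hf'
    (g := fun x => ENNReal.ofReal (Real.exp (1 * x))) (by fun_prop)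
  have hexp := hX.lintegral_exp_mul_esscherDensity (Θ := Θ) 1 (t - s)
  have hfac : ∀ ω, ENNReal.ofReal (discountedPrice S₀ r q X t ω) =
      ENNReal.ofReal (Real.exp (-(r - q) * (t - s : ℝ≥0))) *
        (ENNReal.ofReal (discountedPrice S₀ r q X s ω) *
          ENNReal.ofReal (Real.exp (1 * (X t ω - X s ω)))) := fun ω => by
    rw [← ENNReal.ofReal_mul (discountedPrice_pos hS₀ _ _).le,
      ← ENNReal.ofReal_mul (Real.exp_nonneg _), NNReal.coe_sub hst]
    congr 1
    rw [discountedPrice, discountedPrice]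
    have e1 : -(r - q) * (t : ℝ) = -(r - q) * (t - s) + -(r - q) * s := by ring
    have e2 : X t ω = X s ω + 1 * (X t ω - X s ω) := by ring
    rw [e1, Real.exp_add]
    nth_rw 1 [e2]
    rw [Real.exp_add]
    ring
  have hmeas : Measurable fun ω => f ω * ENNReal.ofReal (discountedPrice S₀ r q X s ω) *
      ENNReal.ofReal (Real.exp (1 * (X t ω - X s ω))) * esscherDensity P X Θ t ω :=
    ((hf'.mono (ℱ.le s) le_rfl).mul
      ((((hX.measurable t).sub (hX.measurable s)).const_mul 1).exp.ennreal_ofReal)).mul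
      ((hX.measurable_esscherDensity Θ t).mono (ℱ.le t) le_rfl)
  calc _ = ∫⁻ ω, ENNReal.ofReal (Real.exp (-(r - q) * (t - s : ℝ≥0))) *
        (f ω * ENNReal.ofReal (discountedPrice S₀ r q X s ω) *
          ENNReal.ofReal (Real.exp (1 * (X t ω - X s ω))) * esscherDensity P X Θ t ω) ∂P := by
        refine lintegral_congr fun ω => ?_
        rw [hfac]
        ring
    _ = _ := by
        rw [lintegral_const_mul _ hmeas, key, hexp, hX.expMoment_eq hap hlp ham hlm h2,
          mul_comm (∫⁻ _, _ ∂P), ← mul_assoc, ← ENNReal.ofReal_mul (Real.exp_nonneg _),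
          ← ENNReal.ofReal_mul (Real.exp_nonneg _), ← Real.exp_add, ← Real.exp_add, drift]
        congr 3
        ring

lemma IsLevyProcess.lintegral_price_zero (hX : IsLevyProcess ℱ P X) [IsProbabilityMeasure P] :
    ∫⁻ ω, ENNReal.ofReal (discountedPrice S₀ r q X 0 ω) * esscherDensity P X Θ 0 ω ∂P =
      ENNReal.ofReal S₀ := by
  have : ∫⁻ ω, ENNReal.ofReal (discountedPrice S₀ r q X 0 ω) * esscherDensity P X Θ 0 ω ∂P =
      ∫⁻ _, ENNReal.ofReal S₀ ∂P := by
    refine lintegral_congr_ae ?_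
    filter_upwards [hX.zero] with ω hω
    simp [discountedPrice, esscherDensity, hω]
  simp [this]

/-- Unlike `IsBilateralGammaProcess.lintegral_price`, this allows an infinite moment, and so detects
non-integrability when `Θ + 1 ≥ lp`. -/
lemma IsLevyProcess.lintegral_price_eq (hX : IsLevyProcess ℱ P X) (hS₀ : 0 < S₀) (t : ℝ≥0) :
    ∫⁻ ω, ENNReal.ofReal (discountedPrice S₀ r q X t ω) * esscherDensity P X Θ t ω ∂P =
      ENNReal.ofReal (Real.exp (-(r - q) * t) * S₀) *
        (ENNReal.ofReal (Real.exp (-(cgf (X 1) P Θ * t))) * expMoment P X (Θ + 1) t) := by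
  have hm : Measurable fun ω =>
      ENNReal.ofReal (Real.exp (1 * X t ω)) * esscherDensity P X Θ t ω :=
    (((hX.measurable t).const_mul 1).exp.ennreal_ofReal).mul
      ((hX.measurable_esscherDensity Θ t).mono (ℱ.le t) le_rfl)
  rw [← hX.lintegral_exp_mul_esscherDensity, ← lintegral_const_mul _ hm]
  refine lintegral_congr fun ω => ?_
  rw [← mul_assoc, ← ENNReal.ofReal_mul (by positivity), one_mul, mul_assoc]
  rfl

/-- The restriction of `ν` to `ℱ t` agrees with the Esscher transform on the discounted price. -/
lemma IsLevyProcess.setLIntegral_price_of_trim (hX : IsLevyProcess ℱ P X) {m' : MeasurableSpace Ω}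
    {ν : Measure[m'] Ω} {t : ℝ≥0} (hle : ℱ t ≤ m') (hν : ν.trim hle = esscher ℱ P X Θ t)
    {A : Set Ω} (hA : MeasurableSet[ℱ t] A) :
    ∫⁻ ω in A, ENNReal.ofReal (discountedPrice S₀ r q X t ω) ∂ν =
      ∫⁻ ω, A.indicator 1 ω * ENNReal.ofReal (discountedPrice S₀ r q X t ω) *
        esscherDensity P X Θ t ω ∂P := by
  have hm : Measurable[ℱ t] fun ω => ENNReal.ofReal (discountedPrice S₀ r q X t ω) :=
    (hX.measurable_discountedPrice t).ennreal_ofReal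
  have hm' : Measurable[ℱ t] fun ω =>
      A.indicator 1 ω * ENNReal.ofReal (discountedPrice S₀ r q X t ω) :=
    (measurable_indicator_one hA).mul hm
  rw [← setLIntegral_trim hle hm hA, hν, ← @lintegral_indicator Ω (ℱ t) _ _ hA,
    ← hX.lintegral_esscher Θ hm']
  refine lintegral_congr fun ω => ?_
  by_cases hω : ω ∈ A <;> simp [hω]

end Price

/-! ### Martingale measures -/

section MartingaleMeasure

variable {Ω : Type*} {m : MeasurableSpace Ω} {ℱ : Filtration ℝ≥0 m} {P : Measure Ω}
  [IsProbabilityMeasure P] {X : ℝ≥0 → Ω → ℝ} {ap lp am lm Θ S₀ r q : ℝ}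

/-- On a filtered space `𝒢 t = ℱ (c t)` carrying a measure which restricts to the Esscher
transform, the time-changed discounted price is a martingale if its drift vanishes. -/
lemma IsBilateralGammaProcess.martingale_price (hX : IsBilateralGammaProcess ℱ P X ap lp am lm)
    (hap : 0 < ap) (hlp : 0 < lp) (ham : 0 < am) (hlm : 0 < lm) (hS₀ : 0 < S₀)
    (hΘ : Θ ∈ Set.Ioo (-lm) (lp - 1)) (hdrift : drift P X r q Θ = 0)
    {m' : MeasurableSpace Ω} {𝒢 : Filtration ℝ≥0 m'} {ν : Measure[m'] Ω}
    [IsProbabilityMeasure ν] {c : ℝ≥0 → ℝ≥0} (hc : Monotone c) (h𝒢 : ∀ t, 𝒢 t = ℱ (c t))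
    (hle : ∀ t, ℱ (c t) ≤ m') (hν : ∀ t, ν.trim (hle t) = esscher ℱ P X Θ (c t)) :
    Martingale (fun t => discountedPrice S₀ r q X (c t)) 𝒢 ν := by
  have hset : ∀ s t, s ≤ t → ∀ A, MeasurableSet[𝒢 s] A →
      ∫⁻ ω in A, ENNReal.ofReal (discountedPrice S₀ r q X (c t) ω) ∂ν =
        ∫⁻ ω in A, ENNReal.ofReal (discountedPrice S₀ r q X (c s) ω) ∂ν := by
    intro s t hst A hA
    rw [h𝒢] at hA
    rw [hX.setLIntegral_price_of_trim (hle t) (hν t) (ℱ.mono (hc hst) _ hA),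
      hX.setLIntegral_price_of_trim (hle s) (hν s) hA,
      hX.lintegral_price hap hlp ham hlm hS₀ hΘ (hc hst) (measurable_indicator_one hA), hdrift]
    simp
  refine martingale_of_setLIntegral_eq (fun t => ?_) (fun t ω => (discountedPrice_pos hS₀ _ ω).le)
    (fun t => ?_) hset
  · rw [h𝒢]
    exact hX.measurable_discountedPrice (c t)
  · have h := hX.setLIntegral_price_of_trim (S₀ := S₀) (r := r) (q := q) (hle t) (hν t)
      (@MeasurableSet.univ Ω (ℱ (c t)))
    have h0 := hX.lintegral_price (r := r) (q := q) hap hlp ham hlm hS₀ hΘ (zero_le (a := c t))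
      (f := fun _ => 1) measurable_const
    simp only [one_mul, hX.lintegral_price_zero] at h0
    rw [setLIntegral_univ] at h
    simp only [Set.indicator_univ, Pi.one_apply, one_mul] at h
    rw [h, h0]
    exact ENNReal.mul_ne_top ENNReal.ofReal_ne_top ENNReal.ofReal_ne_top

/-- On a filtered space which agrees with `ℱ` up to time `1` and carries a measure which restricts
to the Esscher transform, the discounted price can only be a local martingale if it is integrable
and its drift vanishes. -/
lemma IsBilateralGammaProcess.drift_eq_zero_of_isLocalMartingale
    (hX : IsBilateralGammaProcess ℱ P X ap lp am lm)
    (hap : 0 < ap) (hlp : 0 < lp) (ham : 0 < am) (hlm : 0 < lm) (hS₀ : 0 < S₀)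
    (hΘ : Θ ∈ Set.Ioo (-lm) lp)
    {m' : MeasurableSpace Ω} {𝒢 : Filtration ℝ≥0 m'} {ν : Measure[m'] Ω}
    [IsProbabilityMeasure ν] {c : ℝ≥0 → ℝ≥0} (hc1 : ∀ t ≤ 1, c t = t)
    (h𝒢 : ∀ t, 𝒢 t = ℱ (c t)) (hle : ∀ t, ℱ (c t) ≤ m')
    (hν : ∀ t, ν.trim (hle t) = esscher ℱ P X Θ (c t))
    (hcad : ∀ ω, IsCadlagPath fun t => discountedPrice S₀ r q X (c t) ω)
    (hloc : IsLocalMartingale 𝒢 ν fun t => discountedPrice S₀ r q X (c t)) :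
    Θ ∈ Set.Ioo (-lm) (lp - 1) ∧ drift P X r q Θ = 0 := by
  have hnn : ∀ t ω, 0 ≤ discountedPrice S₀ r q X (c t) ω := fun t ω =>
    (discountedPrice_pos hS₀ _ ω).le
  have hset : ∀ t A, MeasurableSet[ℱ (c t)] A →
      ∫⁻ ω in A, ENNReal.ofReal (discountedPrice S₀ r q X (c t) ω) ∂ν =
      ∫⁻ ω, A.indicator 1 ω * ENNReal.ofReal (discountedPrice S₀ r q X (c t) ω) *
        esscherDensity P X Θ (c t) ω ∂P := fun t A hA =>
    hX.setLIntegral_price_of_trim (hle t) (hν t) hA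
  have huniv : ∀ t, ∫⁻ ω, ENNReal.ofReal (discountedPrice S₀ r q X (c t) ω) ∂ν =
      ∫⁻ ω, ENNReal.ofReal (discountedPrice S₀ r q X (c t) ω) *
        esscherDensity P X Θ (c t) ω ∂P := fun t => by
    have := hset t Set.univ (@MeasurableSet.univ Ω (ℱ (c t)))
    rw [setLIntegral_univ] at this
    simpa using this
  have h0 : ∫⁻ ω, ENNReal.ofReal (discountedPrice S₀ r q X (c 0) ω) ∂ν = ENNReal.ofReal S₀ := by
    rw [huniv, hc1 0 zero_le_one, hX.lintegral_price_zero]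
  have hle1 := hloc.lintegral_le hnn 1
  rw [h0] at hle1
  -- Otherwise the price has infinite expectation at time `1`, against the bound by `S₀`.
  have hlt : Θ < lp - 1 := by
    by_contra hcon
    have htop : expMoment P X (Θ + 1) 1 = ⊤ := by
      rw [hX.expMoment_one, lintegral_exp_bilateralGamma_eq_top hap hlp ham hlm (by linarith)]
    rw [huniv, hc1 1 le_rfl, hX.lintegral_price_eq hS₀, htop,
      ENNReal.mul_top (by simp [Real.exp_pos]),
      ENNReal.mul_top (by simpa using mul_pos (Real.exp_pos _) hS₀)] at hle1
    exact ENNReal.ofReal_ne_top (top_le_iff.1 hle1)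
  have hΘ' : Θ ∈ Set.Ioo (-lm) (lp - 1) := ⟨hΘ.1, hlt⟩
  refine ⟨hΘ', ?_⟩
  set κ := drift P X r q Θ with hκ
  have h1 : ∫⁻ ω, ENNReal.ofReal (discountedPrice S₀ r q X (c 1) ω) ∂ν =
      ENNReal.ofReal (Real.exp κ) * ENNReal.ofReal S₀ := by
    have := hX.lintegral_price (r := r) (q := q) hap hlp ham hlm hS₀ hΘ' (zero_le (a := 1))
      (f := fun _ => 1) measurable_const
    simp only [one_mul, hX.lintegral_price_zero] at this
    rw [huniv, hc1 1 le_rfl, this]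
    simp [hκ]
  -- The supermartingale bound reads `exp κ * S₀ ≤ S₀`.
  have hκ0 : κ ≤ 0 := by
    rw [h1, ← ENNReal.ofReal_mul (Real.exp_nonneg _), ENNReal.ofReal_le_ofReal_iff hS₀.le] at hle1
    by_contra hcon
    nlinarith [Real.add_one_le_exp κ]
  -- This is the factor by which the price at `s` exceeds the conditional expectation of the price
  -- at `1`; it is antitone precisely because `κ ≤ 0`.
  let w : ℝ≥0 → ℝ≥0∞ := fun s => ENNReal.ofReal (Real.exp (-κ * (1 - s)))
  have hw : Antitone w := fun s t hst => by
    refine ENNReal.ofReal_le_ofReal (Real.exp_le_exp.2 ?_)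
    have : (s : ℝ) ≤ t := hst
    nlinarith
  have hset1 : ∀ s ≤ 1, ∀ A, MeasurableSet[𝒢 s] A →
      ∫⁻ ω in A, ENNReal.ofReal (discountedPrice S₀ r q X (c s) ω) ∂ν =
        w s * ∫⁻ ω in A, ENNReal.ofReal (discountedPrice S₀ r q X (c 1) ω) ∂ν := by
    intro s hs A hA
    rw [h𝒢] at hA
    have hcs : c s ≤ c 1 := by rw [hc1 s hs, hc1 1 le_rfl]; exact hs
    rw [hset s A hA, hset 1 A (ℱ.mono hcs _ hA),
      hX.lintegral_price hap hlp ham hlm hS₀ hΘ' hcs (measurable_indicator_one hA), ← mul_assoc,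
      ← ENNReal.ofReal_mul (Real.exp_nonneg _), ← Real.exp_add, hc1 s hs, hc1 1 le_rfl,
      NNReal.coe_sub hs, ← hκ]
    have : -κ * (1 - (s : ℝ)) + κ * ((1 : ℝ≥0) - s) = 0 := by push_cast; ring
    rw [this]
    simp
  have hfin : ∫⁻ ω, ENNReal.ofReal (discountedPrice S₀ r q X (c 1) ω) ∂ν ≠ ⊤ := by
    rw [h1]
    exact ENNReal.mul_ne_top ENNReal.ofReal_ne_top ENNReal.ofReal_ne_top
  -- Since `w 1 = 1`, this is the reverse inequality `S₀ ≤ exp κ * S₀`.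
  have hfinal := hloc.lintegral_zero_le hnn
    (fun t => (hX.measurable_discountedPrice (c t)).mono (hle t) le_rfl)
    (fun ω t => (hcad ω t).1) hw ENNReal.ofReal_ne_top hfin hset1
  rw [h0, h1, ← ENNReal.ofReal_mul (Real.exp_nonneg _), ← ENNReal.ofReal_mul (Real.exp_nonneg _),
    ENNReal.ofReal_le_ofReal_iff (by positivity)] at hfinal
  simp only [NNReal.coe_one, sub_self, mul_zero, Real.exp_zero, one_mul] at hfinal
  have : Real.exp 0 ≤ Real.exp κ := by
    rw [Real.exp_zero]
    by_contra hcon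
    nlinarith
  exact le_antisymm hκ0 (Real.exp_le_exp.1 this)

variable (hX : IsBilateralGammaProcess ℱ P X ap lp am lm)
  (hap : 0 < ap) (hlp : 0 < lp) (ham : 0 < am) (hlm : 0 < lm) (hS₀ : 0 < S₀)

include hX hap hlp ham hlm hS₀

lemma IsBilateralGammaProcess.isMartingaleUnder_esscher (hΘ : Θ ∈ Set.Ioo (-lm) (lp - 1))
    (hdrift : drift P X r q Θ = 0) :
    IsMartingaleUnder ℱ (esscher ℱ P X Θ) (discountedPrice S₀ r q X) := by
  intro T
  have hloc := hX.isLocallyEquivalent_esscher hap hlp ham hlm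
    (Θ := Θ) ⟨hΘ.1, by linarith [hΘ.2]⟩
  have := hloc.prob T
  -- The clock `min t T` gives the locally defined setting; the clock `id` later gives the case of a
  -- single measure on `Ω`.
  exact hX.martingale_price (𝒢 := filtrationUpTo ℱ T) (ν := esscher ℱ P X Θ T)
    (c := fun t => min t T) hap hlp ham hlm hS₀ hΘ hdrift
    (fun s t h => min_le_min_right T h) (fun _ => rfl) (fun t => ℱ.mono (min_le_right t T))
    fun t => hloc.consistent _ _ (min_le_right t T)

lemma IsBilateralGammaProcess.isMartingaleMeasure_iff (hΘ : Θ ∈ Set.Ioo (-lm) lp) :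
    IsMartingaleMeasure ℱ P (esscher ℱ P X Θ) (discountedPrice S₀ r q X) ↔
      Θ ∈ Set.Ioo (-lm) (lp - 1) ∧ drift P X r q Θ = 0 := by
  have hloc := hX.isLocallyEquivalent_esscher hap hlp ham hlm hΘ
  have hcad : ∀ T ω, IsCadlagPath fun t => discountedPrice S₀ r q X (min t T) ω := fun T ω =>
    (IsCadlagPath.discountedPrice (hX.cadlag ω)).comp_min T
  constructor
  · intro h
    -- The horizon `T = 1` alone already determines `Θ` and the drift.
    have := hloc.prob 1
    exact hX.drift_eq_zero_of_isLocalMartingale (𝒢 := filtrationUpTo ℱ 1)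
      (ν := esscher ℱ P X Θ 1) (c := fun t => min t 1) hap hlp ham hlm hS₀ hΘ
      (fun t ht => min_eq_left ht) (fun _ => rfl) (fun t => ℱ.mono (min_le_right t 1))
      (fun t => hloc.consistent _ _ (min_le_right t 1)) (hcad 1) (h.2 1)
  · rintro ⟨hΘ', hdrift⟩
    exact ⟨hloc, fun T => IsLocalMartingale.of_martingale
      (hX.isMartingaleUnder_esscher hap hlp ham hlm hS₀ hΘ' hdrift T) (hcad T)⟩

end MartingaleMeasure

end BilateralGamma

/-- Existence of Esscher martingale measures in bilateral Gamma stock models. -/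
theorem mainTheorem1 {Ω : Type*} {m : MeasurableSpace Ω} (ℱ : Filtration ℝ≥0 m)
    (P : Measure Ω) [IsProbabilityMeasure P] (X : ℝ≥0 → Ω → ℝ)
    (ap lp am lm : ℝ) (hap : 0 < ap) (hlp : 0 < lp) (ham : 0 < am) (hlm : 0 < lm)
    (hX : BilateralGamma.IsBilateralGammaProcess ℱ P X ap lp am lm)
    (S₀ r q : ℝ) (hS₀ : 0 < S₀) (hq : 0 ≤ q) (hr : q ≤ r) :
    -- every Esscher transform is a locally equivalent probability measure
    (∀ Θ ∈ Set.Ioo (-lm) lp,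
      BilateralGamma.IsLocallyEquivalent ℱ P (BilateralGamma.esscher ℱ P X Θ)) ∧
    -- one of them is a martingale measure if and only if `lp + lm > 1`
    ((∃ Θ ∈ Set.Ioo (-lm) lp,
      BilateralGamma.IsMartingaleMeasure ℱ P (BilateralGamma.esscher ℱ P X Θ)
        (BilateralGamma.discountedPrice S₀ r q X)) ↔ 1 < lp + lm) ∧
    (1 < lp + lm → ∃ Θ ∈ Set.Ioo (-lm) (lp - 1),
      -- `Θ` is the unique parameter of a martingale measure
      BilateralGamma.IsMartingaleMeasure ℱ P (BilateralGamma.esscher ℱ P X Θ)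
        (BilateralGamma.discountedPrice S₀ r q X) ∧
      (∀ Θ' ∈ Set.Ioo (-lm) lp,
        BilateralGamma.IsMartingaleMeasure ℱ P (BilateralGamma.esscher ℱ P X Θ')
          (BilateralGamma.discountedPrice S₀ r q X) → Θ' = Θ) ∧
      -- the discounted price is even a true martingale
      BilateralGamma.IsMartingaleUnder ℱ (BilateralGamma.esscher ℱ P X Θ)
        (BilateralGamma.discountedPrice S₀ r q X) ∧
      -- `Θ` is the unique solution of the equation
      BilateralGamma.EsscherEquation ap lp am lm r q Θ ∧
      (∀ Θ' ∈ Set.Ioo (-lm) (lp - 1),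
        BilateralGamma.EsscherEquation ap lp am lm r q Θ' → Θ' = Θ) ∧
      -- the law of `X` under the Esscher transform
      BilateralGamma.IsBilateralGammaProcessUnder ℱ (BilateralGamma.esscher ℱ P X Θ) X
        ap (lp - Θ) am (lm + Θ)) ∧
    -- whenever a single probability measure `Q` on `Ω` restricts to the Esscher transform, the
    -- same holds for `Q` itself
    (∀ Θ ∈ Set.Ioo (-lm) lp, ∀ Q : Measure Ω, IsProbabilityMeasure Q →
      (∀ t, Q.trim (ℱ.le t) = BilateralGamma.esscher ℱ P X Θ t) →
      (BilateralGamma.IsLocalMartingale ℱ Q (BilateralGamma.discountedPrice S₀ r q X) ↔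
        BilateralGamma.IsMartingaleMeasure ℱ P (BilateralGamma.esscher ℱ P X Θ)
          (BilateralGamma.discountedPrice S₀ r q X)) ∧
      (Martingale (BilateralGamma.discountedPrice S₀ r q X) ℱ Q ↔
        BilateralGamma.IsMartingaleMeasure ℱ P (BilateralGamma.esscher ℱ P X Θ)
          (BilateralGamma.discountedPrice S₀ r q X)) ∧
      BilateralGamma.IsBilateralGammaProcess ℱ Q X ap (lp - Θ) am (lm + Θ)) := by 
  have hiff : ∀ Θ ∈ Set.Ioo (-lm) lp, BilateralGamma.IsMartingaleMeasure ℱ P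
      (BilateralGamma.esscher ℱ P X Θ) (BilateralGamma.discountedPrice S₀ r q X) ↔
      Θ ∈ Set.Ioo (-lm) (lp - 1) ∧ BilateralGamma.drift P X r q Θ = 0 := fun Θ hΘ =>
    hX.isMartingaleMeasure_iff hap hlp ham hlm hS₀ hΘ
  have hdrift : ∀ Θ ∈ Set.Ioo (-lm) (lp - 1), BilateralGamma.drift P X r q Θ = 0 ↔
      BilateralGamma.EsscherEquation ap lp am lm r q Θ := fun Θ hΘ =>
    hX.drift_eq_zero_iff hap hlp ham hlm hΘ
  have hsub : ∀ Θ ∈ Set.Ioo (-lm) (lp - 1), Θ ∈ Set.Ioo (-lm) lp := fun Θ hΘ =>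
    ⟨hΘ.1, by linarith [hΘ.2]⟩
  have huniq : ∀ Θ ∈ Set.Ioo (-lm) (lp - 1), ∀ Θ' ∈ Set.Ioo (-lm) (lp - 1),
      BilateralGamma.EsscherEquation ap lp am lm r q Θ →
      BilateralGamma.EsscherEquation ap lp am lm r q Θ' → Θ' = Θ := fun Θ hΘ Θ' hΘ' h h' =>
    (BilateralGamma.strictMonoOn_esscherRatio hap ham).injOn hΘ' hΘ (h'.trans h.symm)
  have hex : 1 < lp + lm → ∃ Θ ∈ Set.Ioo (-lm) (lp - 1),
      BilateralGamma.EsscherEquation ap lp am lm r q Θ := fun h =>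
    BilateralGamma.exists_esscherRatio_eq hap ham h (Real.exp_pos _)
  refine ⟨fun Θ hΘ => hX.isLocallyEquivalent_esscher hap hlp ham hlm hΘ, ⟨?_, fun h => ?_⟩,
    fun h => ?_, fun Θ hΘ Q hQ hQe => ?_⟩
  · rintro ⟨Θ, hΘ, hM⟩
    -- Membership in `(-lm, lp - 1)` makes this interval nonempty, which is the condition `1 < lp +
    -- lm`.
    have h := ((hiff Θ hΘ).1 hM).1
    linarith [h.1, h.2]
  · obtain ⟨Θ, hΘ, hE⟩ := hex h
    exact ⟨Θ, hsub Θ hΘ, (hiff Θ (hsub Θ hΘ)).2 ⟨hΘ, (hdrift Θ hΘ).2 hE⟩⟩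
  · obtain ⟨Θ, hΘ, hE⟩ := hex h
    have hd := (hdrift Θ hΘ).2 hE
    refine ⟨Θ, hΘ, (hiff Θ (hsub Θ hΘ)).2 ⟨hΘ, hd⟩, fun Θ' hΘ' hM => ?_,
      hX.isMartingaleUnder_esscher hap hlp ham hlm hS₀ hΘ hd, hE,
      fun Θ' hΘ' hE' => huniq Θ hΘ Θ' hΘ' hE hE',
      hX.isBilateralGammaProcessUnder_esscher hap hlp ham hlm (hsub Θ hΘ)⟩
    obtain ⟨h1, h2⟩ := (hiff Θ' hΘ').1 hM
    exact huniq Θ hΘ Θ' h1 hE ((hdrift Θ' h1).1 h2)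
  · have hcad : ∀ ω, BilateralGamma.IsCadlagPath
        fun t => BilateralGamma.discountedPrice S₀ r q X t ω := fun ω =>
      BilateralGamma.IsCadlagPath.discountedPrice (hX.cadlag ω)
    have hmart : (Θ ∈ Set.Ioo (-lm) (lp - 1) ∧ BilateralGamma.drift P X r q Θ = 0) →
        Martingale (BilateralGamma.discountedPrice S₀ r q X) ℱ Q := fun h =>
      hX.martingale_price (c := id) hap hlp ham hlm hS₀ h.1 h.2 monotone_id (fun _ => rfl)
        (fun t => ℱ.le t) hQe
    have hlocal : BilateralGamma.IsLocalMartingale ℱ Q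
        (BilateralGamma.discountedPrice S₀ r q X) →
        (Θ ∈ Set.Ioo (-lm) (lp - 1) ∧ BilateralGamma.drift P X r q Θ = 0) := fun h =>
      hX.drift_eq_zero_of_isLocalMartingale (c := id) hap hlp ham hlm hS₀ hΘ (fun _ _ => rfl)
        (fun _ => rfl) (fun t => ℱ.le t) hQe hcad h
    refine ⟨(Iff.intro hlocal fun h => ?_).trans (hiff Θ hΘ).symm,
      (Iff.intro (fun h => ?_) hmart).trans (hiff Θ hΘ).symm,
      (hX.isBilateralGammaProcessUnder_esscher hap hlp ham hlm hΘ).of_trim hQe⟩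
    · exact BilateralGamma.IsLocalMartingale.of_martingale (hmart h) hcad
    · exact hlocal (BilateralGamma.IsLocalMartingale.of_martingale h hcad)
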